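/- **Theorem 1.** Let $\bar u:\mathbb R\to\mathbb R$ be absolutely continuous with derivative $\bar u_x\in L^2(\mathbb R)$. For $t>0$ put $A_t=\{x\in\mathbb R:\ \bar u_x(x)>-2/t\}$, put $A_0=\mathbb R$, and for $t\ge 0$, $y\in\mathbb R$ define $$\varphi(t,y)=\frac14\int_{A_t}\operatorname{sign}(y-x)\,\bar u_x^2(x)\,dx,\qquad \xi(t,y)=y+t\,\bar u(y)+\int_0^t(t-s)\,\varphi(s,y)\,ds .$$ Then the integrals in time converge and the following holds. 1. For every $t\ge0$ the map $\xi(t,\cdot):\mathbb R\to\mathbb R$ is nondecreasing and onto. 2. For every $t\ge 0$, if $\xi(t,y_1)=\xi(t,y_2)$ then $\bar u(y_1)+\int_0^t\varphi(s,y_1)\,ds=\bar u(y_2)+\int_0^t\varphi(s,y_2)\,ds$. Hence the formula $$u(t,\xi(t,y))=\bar u(y)+\int_0^t\varphi(s,y)\,ds\qquad(t\ge0,\ y\in\mathbb R)$$ defines a function $u:[0,\infty)\times\mathbb R\to\mathbb R$. 3. For every $t\ge0$, $\displaystyle\int_{\mathbb R}u_x^2(t,x)\,dx=\int_{A_t}\bar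 u_x^2(x)\,dx$. 4. $u$ is a global weak solution of the Hunter–Saxton equation $$u_t+\Big(\frac{u^2}2\Big)_x=\frac14\Big(\int_{-\infty}^x-\int_x^\infty\Big)u_x^2\,dx,\qquad u(0,x)=\bar u(x),$$ that is, for every $T>0$: (i) $u$ is continuous on $[0,T]\times\mathbb R$ and $u(0,x)=\bar u(x)$ for all $x$; (ii) for every $t\in[0,T]$ the function $u(t,\cdot)$ is absolutely continuous with $u_x(t,\cdot)\in L^2(\mathbb R)$, and the map $t\mapsto u_x(t,\cdot)$ belongs to $L^\infty([0,T];L^2(\mathbb R))$; (iii) for every bounded interval $[a,b]$ the map $t\mapsto u(t,\cdot)$ is absolutely continuous from $[0,T]$ to $L^2([a,b])$, and for a.e. $t\in[0,T]$ it is differentiable and the equation holds in $L^2([a,b])$. 5. $u$ is dissipative: for all $0\le t_1\le t_2$ and every compactly supported $C^1$ function $\psi:[0,\infty)\times\mathbb R\to[0,\infty)$, $$\int_{\mathbb R}u_x^2(t_2,x)\,\psi(t_2,x)\,dx-\int_{\mathbb R}u_x^2(t_1,x)\,\psi(t_1,x)\,dx\le\int_{t_1}^{t_2}\!\int_{\mathbb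 R}\big\{u_x^2\,\psi_t+u\,u_x^2\,\psi_x\big\}\,dx\,dt .$$ -/

import Mathlib

open MeasureTheory Set

noncomputable section

namespace HunterSaxton

/-- `f : ℝ → ℝ` is absolutely continuous, i.e. absolutely continuous on every bounded interval.
For functions with square integrable derivative this is the same as the `ε`-`δ` condition on the
whole line, by the Cauchy-Schwarz inequality. -/
def IsAbsCont (f : ℝ → ℝ) : Prop :=
  ∀ a b : ℝ, AbsolutelyContinuousOnInterval f a b

/-- The set `[ū_x > -2/t]` of the points whose gradient has not blown up by time `t`;
at `t = 0` it is the whole line. -/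
def aliveSet (ubar : ℝ → ℝ) (t : ℝ) : Set ℝ :=
  {x | t = 0 ∨ -2 / t < deriv ubar x}

/-- `φ(t,y) = (1/4) ∫_{[ū_x > -2/t]} sign(y-x) ū_x(x)² dx`. -/
def phi (ubar : ℝ → ℝ) (t y : ℝ) : ℝ :=
  (1 / 4) * ∫ x in aliveSet ubar t, Real.sign (y - x) * (deriv ubar x) ^ 2

/-- The characteristic `ξ(t,y) = y + t ū(y) + ∫_0^t (t-s) φ(s,y) ds`. -/
def xi (ubar : ℝ → ℝ) (t y : ℝ) : ℝ :=
  y + t * ubar y + ∫ s in (0 : ℝ)..t, (t - s) * phi ubar s y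

/-- The value `ū(y) + ∫_0^t φ(s,y) ds` carried by the characteristic starting at `y`. -/
def charValue (ubar : ℝ → ℝ) (t y : ℝ) : ℝ :=
  ubar y + ∫ s in (0 : ℝ)..t, phi ubar s y

/-- `u` satisfies the value formula `u(t, ξ(t,y)) = ū(y) + ∫_0^t φ(s,y) ds` for all `t ≥ 0`. -/
def IsGivenByCharacteristics (ubar : ℝ → ℝ) (u : ℝ → ℝ → ℝ) : Prop :=
  ∀ t : ℝ, 0 ≤ t → ∀ y : ℝ, u t (xi ubar t y) = charValue ubar t y

/-- The right-hand side `(1/4) (∫_{-∞}^x - ∫_x^∞) w_x²` of the Hunter-Saxton equation. -/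
def source (w : ℝ → ℝ) (x : ℝ) : ℝ :=
  (1 / 4) * ((∫ z in Iic x, (deriv w z) ^ 2) - ∫ z in Ioi x, (deriv w z) ^ 2)

/-- `u` is a weak solution on `[0,T] × ℝ` of
`u_t + (u²/2)_x = (1/4) (∫_{-∞}^x - ∫_x^∞) u_x² dx`, `u(0,·) = ū`. -/
structure IsWeakSolutionOn (ubar : ℝ → ℝ) (T : ℝ) (u : ℝ → ℝ → ℝ) : Prop where
  /-- `u` is continuous on `[0,T] × ℝ`. -/
  continuousOn : ContinuousOn (Function.uncurry u) (Icc 0 T ×ˢ univ)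
  /-- The initial datum is attained pointwise. -/
  initial : ∀ x : ℝ, u 0 x = ubar x
  /-- `u(t,·)` is absolutely continuous for every `t ∈ [0,T]`. -/
  absCont : ∀ t ∈ Icc (0 : ℝ) T, IsAbsCont (u t)
  /-- `u_x(t,·) ∈ L²(ℝ)` for every `t ∈ [0,T]`. -/
  deriv_memLp : ∀ t ∈ Icc (0 : ℝ) T, MemLp (deriv (u t)) 2 volume
  /-- `t ↦ u_x(t,·)` belongs to `L^∞([0,T]; L²(ℝ))` (as a Bochner space). -/
  deriv_bounded : ∃ V : ℝ → Lp ℝ 2 (volume : Measure ℝ),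
    (∀ t ∈ Icc (0 : ℝ) T, (V t : ℝ → ℝ) =ᵐ[volume] deriv (u t)) ∧
      MemLp V ⊤ (volume.restrict (Icc (0 : ℝ) T))
  /-- For every bounded interval `[a,b]` the map `t ↦ u(t,·) ∈ L²([a,b])` is absolutely
  continuous on `[0,T]`, and for a.e. `t` its derivative, taken in `L²([a,b])`, satisfies the
  equation. -/
  equation : ∀ a b : ℝ, a < b →
    ∃ U : ℝ → Lp ℝ 2 (volume.restrict (Icc a b)),
      (∀ t ∈ Icc (0 : ℝ) T, (U t : ℝ → ℝ) =ᵐ[volume.restrict (Icc a b)] u t) ∧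
      AbsolutelyContinuousOnInterval U 0 T ∧
      ∀ᵐ t ∂(volume.restrict (Icc (0 : ℝ) T)),
        ∃ D : Lp ℝ 2 (volume.restrict (Icc a b)), HasDerivAt U D t ∧
          ∀ᵐ x ∂(volume.restrict (Icc a b)),
            (D : ℝ → ℝ) x + deriv (fun z => (u t z) ^ 2 / 2) x = source (u t) x

/-- The energy density `u_x²` is dissipated: `(u_x²)_t + (u u_x²)_x ≤ 0`, tested between any two
times `0 ≤ t₁ ≤ t₂` against the functions of class `C¹` with compact support which are nonnegative
on `[0,∞) × ℝ`. -/
def IsDissipative (u : ℝ → ℝ → ℝ) : Prop :=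
  ∀ ψ : ℝ × ℝ → ℝ, ContDiff ℝ 1 ψ → HasCompactSupport ψ →
    (∀ t : ℝ, 0 ≤ t → ∀ x : ℝ, 0 ≤ ψ (t, x)) →
    ∀ t₁ t₂ : ℝ, 0 ≤ t₁ → t₁ ≤ t₂ →
      (∫ x, (deriv (u t₂) x) ^ 2 * ψ (t₂, x)) - (∫ x, (deriv (u t₁) x) ^ 2 * ψ (t₁, x)) ≤
        ∫ t in t₁..t₂, ∫ x,
          ((deriv (u t) x) ^ 2 * deriv (fun s => ψ (s, x)) t +
            u t x * (deriv (u t) x) ^ 2 * deriv (fun z => ψ (t, z)) x)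

/-- `u` is a dissipative weak solution with initial datum `ū`, defined for all times `t ≥ 0`. -/
def IsGlobalDissipativeSolution (ubar : ℝ → ℝ) (u : ℝ → ℝ → ℝ) : Prop :=
  (∀ T : ℝ, 0 < T → IsWeakSolutionOn ubar T u) ∧ IsDissipative u

end HunterSaxton

end

/-!
The solution is read off in Lagrangian coordinates, one particle `y` at a time. Along a smooth
solution the gradient obeys the Riccati equation `∂_t u_x = -u_x² / 2`, so a particle of initial
gradient `ū_x < 0` blows up at the time `-2 / ū_x`, and `A_t` is the set of particles still alive at
time `t`. Put `a_t = (1 + t ū_x / 2)₊` (`stretch`); it is positive exactly on `A_t`. Exchanging the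
integrals in time and space in the formulas for `ξ` and for the carried value `v` (`charValue`)
gives

  `ξ_y = a_t²`,  `v_y = ū_x a_t`

(`xi_sub_xi`, `charValue_sub_charValue`). Everything else rests on these two identities.

* *Well-definedness.* By the first, `ξ(t,·)` is nondecreasing. Young's inequality
  `|ū_x a_t| ≤ ε ū_x² + a_t² / (4ε)` bounds increments of `v` by a small amount of energy plus a
  multiple of the increment of `ξ` (`abs_charValue_sub_le`). Hence `v` is a function of `ξ`, and
  this function `u(t,·)` is absolutely continuous (`isAbsCont_profile`).
* *Energy.* `ξ(t,·)` maps the measure `a_t² dy` to the Lebesgue measure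
  (`map_xi_particleMeasure`), and by the chain rule `u_x(t,ξ) a_t = ū_x` on `A_t`. So `u_x² dx` is
  the image of `ū_x² dy` restricted to `A_t` (`integral_deriv_profile_sq_mul`). The energy
  identity and the identification of the source with `φ` (`source_profile`) follow.
* *Strong continuity.* Tested against a continuous function `g` with compact support, `u_x(t,·)`
  gives `∫ ū_x a_t g(ξ(t,y)) dy`, which is continuous in time. The norm of `u_x(t,·)` in `L²` is
  monotone in time, hence continuous off a countable set; at such times weak convergence and
  convergence of norms yield strong continuity of `t ↦ u_x(t,·)` in `L²` (`continuousAt_gradLp`).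
* *The equation.* To compare `u(s,x)` with `u(t,x)`, follow the particle at `x` from time `t` to
  time `s`, then return to `x` along `u(s,·)`. The first step contributes the source, the second
  `-u u_x`. Averages over windows of width `O(|s - t|)` cost `O(|s - t|)` in `L²`
  (`eLpNorm_localMass_le`), so `u` is Lipschitz in time with values in `L²([a,b])`, and is
  differentiable there at every time of continuity of the energy (`hasDerivAt_valueLp`).
* *Dissipation.* The weight `ψ(t,ξ(t,y))` of a single particle changes at the rate `ψ_t + v ψ_x`
  while the particle is alive and drops to zero at its blow-up time
  (`indicator_sub_le_integral_materialDeriv`). Integrating against `ū_x² dy` gives the inequality.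
-/

noncomputable section

namespace HunterSaxton

open Filter Topology

variable {ubar : ℝ → ℝ} {u : ℝ → ℝ → ℝ}

/-! ### Gradients along characteristics -/

/-- The factor `(1 + t ū_x / 2)₊`. Its square is the spatial derivative `ξ_y` of the
characteristic, and `ū_x` times it is the spatial derivative of the value that the characteristic
carries. It vanishes exactly from the blow-up time on. -/
def stretch (ubar : ℝ → ℝ) (t y : ℝ) : ℝ := max (1 + t * deriv ubar y / 2) 0

/-- The energy `∫_{A_t} ū_x²` that is left at time `t`. -/
def energy (ubar : ℝ → ℝ) (t : ℝ) : ℝ := ∫ x in aliveSet ubar t, (deriv ubar x) ^ 2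

lemma mem_aliveSet_iff {t : ℝ} (ht : 0 ≤ t) (x : ℝ) :
    x ∈ aliveSet ubar t ↔ 0 < 1 + t * deriv ubar x / 2 := by
  rcases ht.eq_or_lt with rfl | h
  · simp [aliveSet]
  · have : (t = 0 ∨ -2 / t < deriv ubar x) ↔ -2 / t < deriv ubar x := by
      simp [h.ne']
    simp only [aliveSet, mem_ofPred_eq, this]
    rw [div_lt_iff₀ h]
    constructor <;> intro h' <;> linarith

lemma aliveSet_zero : aliveSet ubar 0 = univ := by
  ext x; simp [aliveSet]

lemma stretch_nonneg (t y : ℝ) : 0 ≤ stretch ubar t y := le_max_right _ _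

lemma mem_aliveSet_iff_stretch_pos {t : ℝ} (ht : 0 ≤ t) (x : ℝ) :
    x ∈ aliveSet ubar t ↔ 0 < stretch ubar t x := by
  rw [mem_aliveSet_iff ht, stretch, lt_max_iff]
  simp

lemma stretch_eq_zero {t : ℝ} (ht : 0 ≤ t) {x : ℝ} (hx : x ∉ aliveSet ubar t) :
    stretch ubar t x = 0 := by
  rw [mem_aliveSet_iff_stretch_pos ht, not_lt] at hx
  exact le_antisymm hx (stretch_nonneg _ _)

lemma aliveSet_antitone {s t : ℝ} (hs : 0 ≤ s) (hst : s ≤ t) :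
    aliveSet ubar t ⊆ aliveSet ubar s := by
  intro x hx
  rw [mem_aliveSet_iff (hs.trans hst)] at hx
  rw [mem_aliveSet_iff hs]
  rcases le_or_gt 0 (deriv ubar x) with h | h
  · have := mul_nonneg hs h; linarith
  · have := mul_le_mul_of_nonpos_right hst h.le
    linarith

lemma measurableSet_aliveSet_prod :
    MeasurableSet {p : ℝ × ℝ | p.2 ∈ aliveSet ubar p.1} := by
  have h1 : MeasurableSet {p : ℝ × ℝ | p.1 = 0} := measurable_fst (measurableSet_singleton 0)
  have h2 : MeasurableSet {p : ℝ × ℝ | -2 / p.1 < deriv ubar p.2} :=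
    measurableSet_lt (measurable_const.div measurable_fst)
      ((measurable_deriv ubar).comp measurable_snd)
  exact h1.union h2

lemma measurableSet_aliveSet (t : ℝ) : MeasurableSet (aliveSet ubar t) :=
  measurableSet_aliveSet_prod.preimage (measurable_prodMk_left (x := t))

lemma measurable_stretch (t : ℝ) : Measurable (stretch ubar t) := by
  have := measurable_deriv ubar
  unfold stretch
  fun_prop

lemma continuous_stretch_time (y : ℝ) : Continuous fun t => stretch ubar t y := by
  unfold stretch; fun_prop

lemma stretch_le {t T : ℝ} (ht : 0 ≤ t) (hT : t ≤ T) (y : ℝ) :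
    stretch ubar t y ≤ 1 + T * |deriv ubar y| := by
  have h1 : t * deriv ubar y ≤ T * |deriv ubar y| :=
    (mul_le_mul_of_nonneg_left (le_abs_self _) ht).trans (by gcongr)
  have h2 : 0 ≤ T * |deriv ubar y| := mul_nonneg (ht.trans hT) (abs_nonneg _)
  exact max_le (by linarith) (by linarith)

lemma intervalIntegrable_of_measurable_of_bounded {g : ℝ → ℝ} (hg : Measurable g) {C : ℝ}
    (hC : ∀ s, |g s| ≤ C) (a b : ℝ) : IntervalIntegrable g volume a b :=
  (intervalIntegrable_const (c := C)).mono_fun hg.aestronglyMeasurable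
    (ae_of_all _ fun s => by
      simpa [Real.norm_eq_abs] using (hC s).trans (le_abs_self C))

lemma measurable_indicator_aliveSet_time (y c : ℝ) :
    Measurable fun s => (aliveSet ubar s).indicator (fun _ => c) y := by
  have : MeasurableSet {s : ℝ | y ∈ aliveSet ubar s} :=
    measurableSet_aliveSet_prod.preimage (measurable_prodMk_right (y := y))
  exact (measurable_const (a := c)).indicator this

/-- Away from the blow-up time of the particle, the stretch factor has slope `ū_x / 2` while the
particle is alive, and slope `0` afterwards. -/
lemma hasDerivAt_stretch {s y : ℝ} (hs : 0 < s) (h : s ≠ -2 / deriv ubar y) :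
    HasDerivAt (fun s => stretch ubar s y)
      ((aliveSet ubar s).indicator (fun _ => deriv ubar y / 2) y) s := by
  have h0 : 1 + s * deriv ubar y / 2 ≠ 0 := by
    intro h0
    have hc : deriv ubar y ≠ 0 := by rintro hc; simp [hc] at h0
    apply h
    field_simp
    linarith
  have hd : HasDerivAt (fun s : ℝ => 1 + s * deriv ubar y / 2) (deriv ubar y / 2) s := by
    simpa using (((hasDerivAt_id s).mul_const (deriv ubar y)).div_const 2).const_add 1
  rcases lt_or_gt_of_ne h0 with h1 | h1
  · have hy : y ∉ aliveSet ubar s := by rw [mem_aliveSet_iff hs.le]; exact h1.le.not_gt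
    rw [indicator_of_notMem hy]
    refine (hasDerivAt_const s (0 : ℝ)).congr_of_eventuallyEq ?_
    filter_upwards [hd.continuousAt.eventually_lt continuousAt_const h1] with r hr
    exact max_eq_right hr.le
  · have hy : y ∈ aliveSet ubar s := by rw [mem_aliveSet_iff hs.le]; exact h1
    rw [indicator_of_mem hy]
    refine hd.congr_of_eventuallyEq ?_
    filter_upwards [continuousAt_const.eventually_lt hd.continuousAt h1] with r hr
    exact max_eq_left hr.le

/-- The gradient `v_y = ū_x (1 + t ū_x / 2)₊` of the value carried by a characteristic solves
`∂_t v_y = ū_x² / 2` up to the blow-up time. -/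
lemma integral_indicator_aliveSet (y : ℝ) {t : ℝ} (ht : 0 ≤ t) :
    ∫ s in (0 : ℝ)..t, (aliveSet ubar s).indicator (fun _ => deriv ubar y ^ 2 / 2) y =
      deriv ubar y * stretch ubar t y - deriv ubar y := by
  rw [integral_eq_of_hasDerivAt_off_countable (fun s => deriv ubar y * stretch ubar s y) _
    (countable_singleton (-2 / deriv ubar y))
    (continuous_const.mul (continuous_stretch_time y)).continuousOn ?_
    (intervalIntegrable_of_measurable_of_bounded (C := |deriv ubar y ^ 2 / 2|)
      (measurable_indicator_aliveSet_time y _) ?_ _ _)]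
  · simp [stretch]
  · rintro s ⟨hs, hs'⟩
    rw [min_eq_left ht] at hs
    convert! (hasDerivAt_stretch hs.1 hs').const_mul (deriv ubar y) using 1
    by_cases h : y ∈ aliveSet ubar s <;> simp [h]
    ring
  · intro s
    by_cases h : y ∈ aliveSet ubar s <;> simp [h]

/-- Integrating the gradient equation twice in time gives the square of the stretch factor. -/
lemma integral_sub_mul_indicator_aliveSet (y : ℝ) {t : ℝ} (ht : 0 ≤ t) :
    ∫ s in (0 : ℝ)..t, (t - s) * (aliveSet ubar s).indicator (fun _ => deriv ubar y ^ 2 / 2) y =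
      stretch ubar t y ^ 2 - t * deriv ubar y - 1 := by
  have hcont := continuous_stretch_time (ubar := ubar) y
  rw [integral_eq_of_hasDerivAt_off_countable
    (fun s => (t - s) * (deriv ubar y * stretch ubar s y) + stretch ubar s y ^ 2) _
    (countable_singleton (-2 / deriv ubar y)) (by fun_prop) ?_ ?_]
  · simp [stretch]; ring
  · rintro s ⟨hs, hs'⟩
    rw [min_eq_left ht] at hs
    have h1 := hasDerivAt_stretch hs.1 hs'
    convert! (((hasDerivAt_id s).const_sub t).mul (h1.const_mul (deriv ubar y))).add
      (h1.pow 2) using 1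
    by_cases h : y ∈ aliveSet ubar s
    · have h2 : stretch ubar s y = 1 + s * deriv ubar y / 2 :=
        max_eq_left ((mem_aliveSet_iff hs.1.le y).1 h).le
      simp [h, h2]
      ring
    · simp [h, stretch_eq_zero hs.1.le h]
  · refine IntervalIntegrable.continuousOn_mul ?_ (by fun_prop)
    refine intervalIntegrable_of_measurable_of_bounded (C := |deriv ubar y ^ 2 / 2|)
      (measurable_indicator_aliveSet_time y _) (fun s => ?_) _ _
    by_cases h : y ∈ aliveSet ubar s <;> simp [h]

/-! ### The source along characteristics -/

lemma measurable_sign_sub (y : ℝ) : Measurable fun x => Real.sign (y - x) := by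
  unfold Real.sign
  exact Measurable.ite (measurableSet_lt (by fun_prop) (by fun_prop)) measurable_const
    (Measurable.ite (measurableSet_lt (by fun_prop) (by fun_prop)) measurable_const
      measurable_const)

lemma abs_sign_le_one (r : ℝ) : |Real.sign r| ≤ 1 := by
  rcases Real.sign_apply_eq r with h | h | h <;> simp [h]

lemma integrable_sign_mul (hw : Integrable fun x => deriv ubar x ^ 2) (y : ℝ) :
    Integrable fun x => Real.sign (y - x) * deriv ubar x ^ 2 :=
  hw.bdd_mul (measurable_sign_sub y).aestronglyMeasurable
    (ae_of_all _ fun x => abs_sign_le_one (y - x))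

lemma energy_nonneg (t : ℝ) : 0 ≤ energy ubar t :=
  integral_nonneg fun _ => sq_nonneg _

lemma energy_zero : energy ubar 0 = ∫ x, deriv ubar x ^ 2 := by
  simp [energy, aliveSet_zero]

lemma energy_le (hw : Integrable fun x => deriv ubar x ^ 2) (t : ℝ) :
    energy ubar t ≤ energy ubar 0 := by
  rw [energy_zero]
  exact setIntegral_le_integral hw (ae_of_all _ fun _ => sq_nonneg _)

lemma energy_antitone (hw : Integrable fun x => deriv ubar x ^ 2) {s t : ℝ} (hs : 0 ≤ s)
    (hst : s ≤ t) : energy ubar t ≤ energy ubar s :=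
  setIntegral_mono_set hw.integrableOn (ae_of_all _ fun _ => sq_nonneg _)
    (aliveSet_antitone hs hst).eventuallyLE

lemma abs_phi_le (hw : Integrable fun x => deriv ubar x ^ 2) (s y : ℝ) :
    |phi ubar s y| ≤ energy ubar 0 / 4 := by
  have h : |∫ x in aliveSet ubar s, Real.sign (y - x) * deriv ubar x ^ 2| ≤ energy ubar s := by
    rw [← Real.norm_eq_abs]
    refine norm_integral_le_of_norm_le hw.integrableOn (ae_of_all _ fun x => ?_)
    rw [Real.norm_eq_abs, abs_mul, abs_of_nonneg (sq_nonneg (deriv ubar x))]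
    exact mul_le_of_le_one_left (sq_nonneg _) (abs_sign_le_one _)
  rw [phi, abs_mul, abs_of_pos (by norm_num : (0 : ℝ) < 1 / 4)]
  linarith [energy_le hw s]

lemma measurable_phi (y : ℝ) : Measurable fun s => phi ubar s y := by
  have h1 : Measurable fun p : ℝ × ℝ => Real.sign (y - p.2) * deriv ubar p.2 ^ 2 :=
    ((measurable_sign_sub y).comp measurable_snd).mul
      (((measurable_deriv ubar).comp measurable_snd).pow_const 2)
  have h2 : StronglyMeasurable fun s : ℝ => ∫ x,
      {p : ℝ × ℝ | p.2 ∈ aliveSet ubar p.1}.indicator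
        (fun p : ℝ × ℝ => Real.sign (y - p.2) * deriv ubar p.2 ^ 2) (s, x) :=
    (h1.indicator measurableSet_aliveSet_prod).stronglyMeasurable.integral_prod_right'
  have h3 : (fun s => phi ubar s y) = fun s => (1 / 4) * ∫ x,
      {p : ℝ × ℝ | p.2 ∈ aliveSet ubar p.1}.indicator
        (fun p : ℝ × ℝ => Real.sign (y - p.2) * deriv ubar p.2 ^ 2) (s, x) := by
    funext s
    rw [phi, ← integral_indicator (measurableSet_aliveSet s)]
    rfl
  rw [h3]
  exact h2.measurable.const_mul _

lemma intervalIntegrable_phi (hw : Integrable fun x => deriv ubar x ^ 2) (y a b : ℝ) :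
    IntervalIntegrable (fun s => phi ubar s y) volume a b :=
  intervalIntegrable_of_measurable_of_bounded (measurable_phi y) (fun s => abs_phi_le hw s y) a b

lemma phi_sub_phi (hw : Integrable fun x => deriv ubar x ^ 2) (s : ℝ) {y₁ y₂ : ℝ}
    (h : y₁ ≤ y₂) : phi ubar s y₂ - phi ubar s y₁ =
      ∫ x in y₁..y₂, (aliveSet ubar s).indicator (fun _ => deriv ubar x ^ 2 / 2) x := by
  rw [phi, phi, ← mul_sub, ← integral_sub (integrable_sign_mul hw _).integrableOn
    (integrable_sign_mul hw _).integrableOn, ← integral_indicator (measurableSet_aliveSet s),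
    intervalIntegral.integral_of_le h, ← integral_indicator measurableSet_Ioc,
    ← integral_const_mul]
  refine integral_congr_ae ?_
  filter_upwards [(countable_singleton y₁).ae_notMem volume,
    (countable_singleton y₂).ae_notMem volume] with x hx1 hx2
  simp only [mem_singleton_iff] at hx1 hx2
  by_cases hx : x ∈ aliveSet ubar s
  · rcases lt_or_gt_of_ne hx1 with h1 | h1
    · have h3 : x ∉ Ioc y₁ y₂ := fun h' => h'.1.not_gt h1
      simp [hx, h3, Real.sign_of_pos (sub_pos.2 h1), Real.sign_of_pos (sub_pos.2 (h1.trans_le h))]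
    · rcases lt_or_gt_of_ne hx2 with h2 | h2
      · have h3 : x ∈ Ioc y₁ y₂ := ⟨h1, h2.le⟩
        simp [hx, h3, Real.sign_of_neg (sub_neg.2 h1), Real.sign_of_pos (sub_pos.2 h2)]
        ring
      · have h3 : x ∉ Ioc y₁ y₂ := fun h' => h'.2.not_gt h2
        simp [hx, h3, Real.sign_of_neg (sub_neg.2 h1), Real.sign_of_neg (sub_neg.2 h2)]
  · by_cases h1 : x ∈ Ioc y₁ y₂ <;> simp [hx, h1]

/-- The source varies in time only through the energy that is lost. -/
lemma abs_phi_sub_phi_le (hw : Integrable fun x => deriv ubar x ^ 2) {s t : ℝ} (hs : 0 ≤ s)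
    (ht : 0 ≤ t) (y : ℝ) :
    |phi ubar s y - phi ubar t y| ≤ |energy ubar s - energy ubar t| / 4 := by
  wlog hst : s ≤ t generalizing s t
  · rw [abs_sub_comm, abs_sub_comm (energy ubar s)]
    exact this ht hs (le_of_not_ge hst)
  have hsub := aliveSet_antitone (ubar := ubar) hs hst
  rw [abs_of_nonneg (sub_nonneg.2 (energy_antitone hw hs hst)), phi, phi, ← mul_sub,
    ← setIntegral_sdiff (measurableSet_aliveSet t) (integrable_sign_mul hw y).integrableOn hsub,
    energy, energy, ← setIntegral_sdiff (measurableSet_aliveSet t) hw.integrableOn hsub,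
    abs_mul, abs_of_pos (by norm_num : (0 : ℝ) < 1 / 4)]
  have : |∫ x in aliveSet ubar s \ aliveSet ubar t, Real.sign (y - x) * deriv ubar x ^ 2| ≤
      ∫ x in aliveSet ubar s \ aliveSet ubar t, deriv ubar x ^ 2 := by
    rw [← Real.norm_eq_abs]
    refine norm_integral_le_of_norm_le hw.integrableOn (ae_of_all _ fun x => ?_)
    rw [Real.norm_eq_abs, abs_mul, abs_of_nonneg (sq_nonneg (deriv ubar x))]
    exact mul_le_of_le_one_left (sq_nonneg _) (abs_sign_le_one _)
  linarith

/-! ### Characteristics -/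

lemma integral_deriv_ubar (hac : IsAbsCont ubar) (a b : ℝ) :
    ∫ x in a..b, deriv ubar x = ubar b - ubar a :=
  (hac a b).integral_deriv_eq_sub

lemma integrableOn_time_space (hw : Integrable fun x => deriv ubar x ^ 2) {k : ℝ → ℝ}
    (hk : Continuous k) (t y₁ y₂ : ℝ) :
    IntegrableOn (Function.uncurry fun s x => k s *
      (aliveSet ubar s).indicator (fun _ => deriv ubar x ^ 2 / 2) x)
      (uIoc 0 t ×ˢ uIoc y₁ y₂) volume := by
  have hk1 : IntegrableOn k (uIoc 0 t) := hk.integrableOn_uIoc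
  have h1 : Integrable (fun p : ℝ × ℝ => k p.1 * (deriv ubar p.2 ^ 2 / 2))
      ((volume.restrict (uIoc 0 t)).prod (volume.restrict (uIoc y₁ y₂))) :=
    Integrable.mul_prod hk1 (hw.div_const 2).integrableOn
  rw [Measure.prod_restrict] at h1
  refine (h1.indicator (measurableSet_aliveSet_prod (ubar := ubar))).congr
    (ae_of_all _ fun p => ?_)
  by_cases h : p.2 ∈ aliveSet ubar p.1 <;> simp [h, Function.uncurry]

lemma intervalIntegrable_deriv_mul_stretch (hac : IsAbsCont ubar)
    (hw : Integrable fun x => deriv ubar x ^ 2) {t : ℝ} (ht : 0 ≤ t) (a b : ℝ) :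
    IntervalIntegrable (fun y => deriv ubar y * stretch ubar t y) volume a b := by
  have h1 : IntervalIntegrable (deriv ubar) volume a b := (hac a b).intervalIntegrable_deriv
  have h2 : IntervalIntegrable (fun x => deriv ubar x ^ 2) volume a b := hw.intervalIntegrable
  have hm := measurable_deriv ubar
  have hs := measurable_stretch (ubar := ubar) t
  have hle := fun y => stretch_le (ubar := ubar) ht le_rfl y
  refine (h1.abs.add (h2.const_mul t)).mono_fun (by fun_prop) (ae_of_all _ fun y => ?_)
  have h3 := hle y
  have h4 : 0 ≤ |deriv ubar y| + t * deriv ubar y ^ 2 := by positivity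
  dsimp only
  rw [Real.norm_eq_abs, Real.norm_eq_abs, abs_of_nonneg h4, abs_mul,
    abs_of_nonneg (stretch_nonneg t y), ← sq_abs (deriv ubar y)]
  nlinarith [abs_nonneg (deriv ubar y)]

lemma intervalIntegrable_stretch_sq (hw : Integrable fun x => deriv ubar x ^ 2) {t : ℝ}
    (ht : 0 ≤ t) (a b : ℝ) :
    IntervalIntegrable (fun y => stretch ubar t y ^ 2) volume a b := by
  have h2 : IntervalIntegrable (fun x => deriv ubar x ^ 2) volume a b := hw.intervalIntegrable
  have hm := measurable_deriv ubar
  have hs := measurable_stretch (ubar := ubar) t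
  have hle := fun y => stretch_le (ubar := ubar) ht le_rfl y
  refine ((intervalIntegrable_const (c := (2 : ℝ))).add
    (h2.const_mul (2 * t ^ 2))).mono_fun (by fun_prop) (ae_of_all _ fun y => ?_)
  have h3 := hle y
  have h4 : 0 ≤ 2 + 2 * t ^ 2 * deriv ubar y ^ 2 := by positivity
  dsimp only
  rw [Real.norm_eq_abs, Real.norm_eq_abs, abs_of_nonneg h4, abs_of_nonneg (sq_nonneg _),
    ← sq_abs (deriv ubar y)]
  nlinarith [stretch_nonneg (ubar := ubar) t y, sq_nonneg (1 - t * |deriv ubar y|)]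

/-- The value carried by characteristics has spatial derivative `ū_x (1 + t ū_x / 2)₊`. -/
lemma charValue_sub_charValue (hac : IsAbsCont ubar)
    (hw : Integrable fun x => deriv ubar x ^ 2) {t : ℝ} (ht : 0 ≤ t) {y₁ y₂ : ℝ}
    (h : y₁ ≤ y₂) : charValue ubar t y₂ - charValue ubar t y₁ =
      ∫ y in y₁..y₂, deriv ubar y * stretch ubar t y := by
  have h1 : (∫ s in (0 : ℝ)..t, phi ubar s y₂) - ∫ s in (0 : ℝ)..t, phi ubar s y₁ =
      ∫ x in y₁..y₂, (deriv ubar x * stretch ubar t x - deriv ubar x) := by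
    rw [← intervalIntegral.integral_sub (intervalIntegrable_phi hw _ _ _)
      (intervalIntegrable_phi hw _ _ _)]
    simp_rw [phi_sub_phi hw _ h]
    rw [intervalIntegral_intervalIntegral_swap]
    · simp_rw [integral_indicator_aliveSet _ ht]
    · simpa using integrableOn_time_space hw (k := fun _ => 1) continuous_const t y₁ y₂
  rw [intervalIntegral.integral_sub (intervalIntegrable_deriv_mul_stretch hac hw ht _ _)
    (hac _ _).intervalIntegrable_deriv, integral_deriv_ubar hac] at h1
  simp only [charValue]
  linarith

/-- The characteristics have spatial derivative `((1 + t ū_x / 2)₊)²`. -/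
lemma xi_sub_xi (hac : IsAbsCont ubar)
    (hw : Integrable fun x => deriv ubar x ^ 2) {t : ℝ} (ht : 0 ≤ t) {y₁ y₂ : ℝ}
    (h : y₁ ≤ y₂) : xi ubar t y₂ - xi ubar t y₁ = ∫ y in y₁..y₂, stretch ubar t y ^ 2 := by
  have hphi : ∀ y, IntervalIntegrable (fun s => (t - s) * phi ubar s y) volume 0 t := fun y =>
    (intervalIntegrable_phi hw y 0 t).continuousOn_mul (by fun_prop)
  have h1 : (∫ s in (0 : ℝ)..t, (t - s) * phi ubar s y₂) -
      ∫ s in (0 : ℝ)..t, (t - s) * phi ubar s y₁ =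
      ∫ x in y₁..y₂, (stretch ubar t x ^ 2 - t * deriv ubar x - 1) := by
    rw [← intervalIntegral.integral_sub (hphi _) (hphi _)]
    simp_rw [← mul_sub, phi_sub_phi hw _ h, ← intervalIntegral.integral_const_mul]
    rw [intervalIntegral_intervalIntegral_swap]
    · simp_rw [integral_sub_mul_indicator_aliveSet _ ht]
    · exact integrableOn_time_space hw (k := fun s => t - s) (by fun_prop) t y₁ y₂
  have hd : IntervalIntegrable (fun x => t * deriv ubar x) volume y₁ y₂ :=
    (hac _ _).intervalIntegrable_deriv.const_mul t
  have hs := intervalIntegrable_stretch_sq hw ht y₁ y₂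
  rw [intervalIntegral.integral_sub (hs.sub hd) intervalIntegrable_const,
    intervalIntegral.integral_sub hs hd, intervalIntegral.integral_const_mul,
    integral_deriv_ubar hac] at h1
  simp only [intervalIntegral.integral_const, smul_eq_mul, mul_one] at h1
  simp only [xi]
  linarith

lemma monotone_xi (hac : IsAbsCont ubar) (hw : Integrable fun x => deriv ubar x ^ 2) {t : ℝ}
    (ht : 0 ≤ t) : Monotone (xi ubar t) := by
  intro y₁ y₂ h
  have h1 := xi_sub_xi hac hw ht h
  have h2 : 0 ≤ ∫ y in y₁..y₂, stretch ubar t y ^ 2 :=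
    intervalIntegral.integral_nonneg h fun y _ => sq_nonneg _
  linarith

/-- Young's inequality between the gradients of the value and of the characteristic. It replaces
the Cauchy–Schwarz inequality, being additive over disjoint intervals. -/
lemma abs_charValue_sub_le (hac : IsAbsCont ubar) (hw : Integrable fun x => deriv ubar x ^ 2)
    {t : ℝ} (ht : 0 ≤ t) {y₁ y₂ : ℝ} (h : y₁ ≤ y₂) {ε : ℝ} (hε : 0 < ε) :
    |charValue ubar t y₂ - charValue ubar t y₁| ≤
      ε * (∫ y in y₁..y₂, deriv ubar y ^ 2) + (xi ubar t y₂ - xi ubar t y₁) / (4 * ε) := by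
  have h1 : IntervalIntegrable (fun x => deriv ubar x ^ 2) volume y₁ y₂ := hw.intervalIntegrable
  have h2 := intervalIntegrable_stretch_sq hw ht y₁ y₂
  rw [charValue_sub_charValue hac hw ht h, xi_sub_xi hac hw ht h,
    ← intervalIntegral.integral_const_mul, ← intervalIntegral.integral_div,
    ← intervalIntegral.integral_add (h1.const_mul ε) (h2.div_const _), ← Real.norm_eq_abs]
  refine intervalIntegral.norm_integral_le_of_norm_le h (ae_of_all _ fun y _ => ?_)
    ((h1.const_mul ε).add (h2.div_const _))
  rw [Real.norm_eq_abs]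
  have h3 : ε * deriv ubar y ^ 2 + stretch ubar t y ^ 2 / (4 * ε) -
      |deriv ubar y * stretch ubar t y| =
      (2 * ε * |deriv ubar y| - stretch ubar t y) ^ 2 / (4 * ε) := by
    rw [abs_mul, abs_of_nonneg (stretch_nonneg t y), ← sq_abs (deriv ubar y)]
    field_simp
    ring
  have h4 : 0 ≤ (2 * ε * |deriv ubar y| - stretch ubar t y) ^ 2 / (4 * ε) := by positivity
  linarith

lemma integral_sq_le_energy (hw : Integrable fun x => deriv ubar x ^ 2) {y₁ y₂ : ℝ}
    (h : y₁ ≤ y₂) : ∫ y in y₁..y₂, deriv ubar y ^ 2 ≤ energy ubar 0 := by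
  rw [energy_zero, intervalIntegral.integral_of_le h]
  exact setIntegral_le_integral hw (ae_of_all _ fun x => sq_nonneg _)

lemma charValue_eq_of_xi_eq (hac : IsAbsCont ubar)
    (hw : Integrable fun x => deriv ubar x ^ 2) {t : ℝ} (ht : 0 ≤ t) {y₁ y₂ : ℝ}
    (h : xi ubar t y₁ = xi ubar t y₂) : charValue ubar t y₁ = charValue ubar t y₂ := by
  wlog hle : y₁ ≤ y₂ generalizing y₁ y₂
  · exact (this h.symm (le_of_not_ge hle)).symm
  have hE := energy_nonneg (ubar := ubar) 0
  refine (sub_eq_zero.1 (abs_eq_zero.1 (le_antisymm ?_ (abs_nonneg _)))).symm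
  -- Young's inequality with a vanishing coefficient in front of the energy
  refine le_of_forall_pos_le_add fun ε hε => ?_
  have h1 := abs_charValue_sub_le hac hw ht hle (div_pos hε (by linarith : 0 < energy ubar 0 + 1))
  rw [h, sub_self, zero_div, add_zero] at h1
  refine h1.trans ?_
  rw [zero_add, div_mul_eq_mul_div, div_le_iff₀ (by linarith)]
  have := integral_sq_le_energy hw hle
  nlinarith

lemma charValue_zero (y : ℝ) : charValue ubar 0 y = ubar y := by simp [charValue]

lemma xi_zero (y : ℝ) : xi ubar 0 y = y := by simp [xi]

lemma abs_charValue_sub_time_le (hw : Integrable fun x => deriv ubar x ^ 2) (s t y : ℝ) :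
    |charValue ubar s y - charValue ubar t y| ≤ energy ubar 0 / 4 * |s - t| := by
  rw [charValue, charValue, add_sub_add_left_eq_sub, intervalIntegral.integral_interval_sub_left
    (intervalIntegrable_phi hw _ _ _) (intervalIntegrable_phi hw _ _ _), ← Real.norm_eq_abs]
  exact intervalIntegral.norm_integral_le_of_norm_le_const fun r _ => abs_phi_le hw r y

/-- At a time of continuity of the energy, the value carried by a characteristic is differentiable
in time, uniformly with respect to the characteristic. -/
lemma eventually_abs_charValue_sub_sub_le (hw : Integrable fun x => deriv ubar x ^ 2) {t : ℝ}
    (ht : 0 < t) (hc : ContinuousAt (energy ubar) t) {ε : ℝ} (hε : 0 < ε) :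
    ∀ᶠ s in 𝓝 t, ∀ y,
      |charValue ubar s y - charValue ubar t y - (s - t) * phi ubar t y| ≤ ε * |s - t| := by
  obtain ⟨δ, hδ, hδ'⟩ := Metric.continuousAt_iff.1 hc (4 * ε) (by positivity)
  filter_upwards [Metric.ball_mem_nhds t (lt_min hδ ht)] with s hs y
  rw [Metric.mem_ball, Real.dist_eq, lt_min_iff] at hs
  have h1 : charValue ubar s y - charValue ubar t y - (s - t) * phi ubar t y =
      ∫ r in t..s, (phi ubar r y - phi ubar t y) := by
    rw [intervalIntegral.integral_sub (intervalIntegrable_phi hw _ _ _) intervalIntegrable_const,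
      charValue, charValue, add_sub_add_left_eq_sub, intervalIntegral.integral_interval_sub_left
      (intervalIntegrable_phi hw _ _ _) (intervalIntegrable_phi hw _ _ _)]
    simp
  rw [h1, ← Real.norm_eq_abs]
  refine intervalIntegral.norm_integral_le_of_norm_le_const fun r hr => ?_
  have hr' : |r - t| ≤ |s - t| := abs_sub_left_of_mem_uIcc (uIoc_subset_uIcc hr)
  have hr0 : 0 ≤ r := by
    have := (abs_lt.1 (hr'.trans_lt hs.2)).1
    linarith
  have h2 := hδ' (x := r) (by rw [Real.dist_eq]; exact hr'.trans_lt hs.1)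
  rw [Real.dist_eq] at h2
  rw [Real.norm_eq_abs]
  have h3 := abs_phi_sub_phi_le hw hr0 ht.le y
  linarith

lemma intervalIntegrable_sub_mul_phi (hw : Integrable fun x => deriv ubar x ^ 2) (t y a b : ℝ) :
    IntervalIntegrable (fun s => (t - s) * phi ubar s y) volume a b :=
  (intervalIntegrable_phi hw y a b).continuousOn_mul (by fun_prop)

/-- Characteristics move with the value that they carry. -/
lemma abs_xi_sub_sub_le (hw : Integrable fun x => deriv ubar x ^ 2) (s t y : ℝ) :
    |xi ubar s y - xi ubar t y - (s - t) * charValue ubar t y| ≤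
      energy ubar 0 / 4 * (s - t) ^ 2 := by
  have h1 : xi ubar s y - xi ubar t y - (s - t) * charValue ubar t y =
      ∫ r in t..s, (s - r) * phi ubar r y := by
    have h2 : ∫ r in (0 : ℝ)..t, (s - r) * phi ubar r y =
        (∫ r in (0 : ℝ)..t, (t - r) * phi ubar r y) +
          (s - t) * ∫ r in (0 : ℝ)..t, phi ubar r y := by
      rw [← intervalIntegral.integral_const_mul, ← intervalIntegral.integral_add
        (intervalIntegrable_sub_mul_phi hw _ _ _ _) ((intervalIntegrable_phi hw _ _ _).const_mul _)]
      congr 1 with r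
      ring
    rw [← intervalIntegral.integral_interval_sub_left (intervalIntegrable_sub_mul_phi hw s y 0 s)
      (intervalIntegrable_sub_mul_phi hw s y 0 t), h2]
    simp only [xi, charValue]
    ring
  have h3 : energy ubar 0 / 4 * (s - t) ^ 2 = |s - t| * (energy ubar 0 / 4) * |s - t| := by
    rw [← sq_abs]; ring
  rw [h1, h3, ← Real.norm_eq_abs]
  refine intervalIntegral.norm_integral_le_of_norm_le_const fun r hr => ?_
  rw [Real.norm_eq_abs, abs_mul]
  have := abs_sub_right_of_mem_uIcc (uIoc_subset_uIcc hr)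
  exact mul_le_mul this (abs_phi_le hw r y) (abs_nonneg _) (abs_nonneg _)

lemma hasDerivAt_xi (hw : Integrable fun x => deriv ubar x ^ 2) (t y : ℝ) :
    HasDerivAt (fun s => xi ubar s y) (charValue ubar t y) t := by
  rw [hasDerivAt_iff_isLittleO]
  refine Asymptotics.IsBigO.trans_isLittleO (g := fun s => (s - t) ^ 2) ?_ ?_
  · refine Asymptotics.IsBigO.of_bound (energy ubar 0 / 4) (Eventually.of_forall fun s => ?_)
    rw [Real.norm_eq_abs, Real.norm_eq_abs, abs_of_nonneg (sq_nonneg (s - t)), smul_eq_mul]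
    exact abs_xi_sub_sub_le hw s t y
  · have h := (Asymptotics.isLittleO_pow_id (𝕜 := ℝ) (n := 2) (by norm_num)).comp_tendsto
      (k := fun s => s - t) (l' := 𝓝 t) (by
        have : Tendsto (fun s => s - t) (𝓝 t) (𝓝 (t - t)) := tendsto_id.sub_const t
        simpa using this)
    exact h

lemma continuous_charValue_time (hw : Integrable fun x => deriv ubar x ^ 2) (y : ℝ) :
    Continuous fun t => charValue ubar t y :=
  continuous_const.add (intervalIntegral.continuous_primitive
    (fun a b => intervalIntegrable_phi hw y a b) 0)

lemma continuous_xi_time (hw : Integrable fun x => deriv ubar x ^ 2) (y : ℝ) :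
    Continuous fun t => xi ubar t y :=
  continuous_iff_continuousAt.2 fun t => (hasDerivAt_xi hw t y).continuousAt

lemma charValue_eq_add_integral (hac : IsAbsCont ubar)
    (hw : Integrable fun x => deriv ubar x ^ 2) {t : ℝ} (ht : 0 ≤ t) :
    charValue ubar t = fun y => charValue ubar t 0 +
      ∫ x in (0 : ℝ)..y, deriv ubar x * stretch ubar t x := by
  funext y
  rcases le_total 0 y with hy | hy
  · rw [← charValue_sub_charValue hac hw ht hy]; ring
  · rw [intervalIntegral.integral_symm, ← charValue_sub_charValue hac hw ht hy]; ring

lemma continuous_charValue (hac : IsAbsCont ubar) (hw : Integrable fun x => deriv ubar x ^ 2)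
    {t : ℝ} (ht : 0 ≤ t) : Continuous (charValue ubar t) := by
  rw [charValue_eq_add_integral hac hw ht]
  exact continuous_const.add (intervalIntegral.continuous_primitive
    (fun a b => intervalIntegrable_deriv_mul_stretch hac hw ht a b) 0)

lemma xi_eq_add_integral (hac : IsAbsCont ubar) (hw : Integrable fun x => deriv ubar x ^ 2)
    {t : ℝ} (ht : 0 ≤ t) : xi ubar t = fun y => xi ubar t 0 +
      ∫ x in (0 : ℝ)..y, stretch ubar t x ^ 2 := by
  funext y
  rcases le_total 0 y with hy | hy
  · rw [← xi_sub_xi hac hw ht hy]; ring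
  · rw [intervalIntegral.integral_symm, ← xi_sub_xi hac hw ht hy]; ring

lemma continuous_xi (hac : IsAbsCont ubar) (hw : Integrable fun x => deriv ubar x ^ 2)
    {t : ℝ} (ht : 0 ≤ t) : Continuous (xi ubar t) := by
  rw [xi_eq_add_integral hac hw ht]
  exact continuous_const.add (intervalIntegral.continuous_primitive
    (fun a b => intervalIntegrable_stretch_sq hw ht a b) 0)

lemma continuousAt_charValue_prod (hac : IsAbsCont ubar)
    (hw : Integrable fun x => deriv ubar x ^ 2) {t : ℝ} (ht : 0 ≤ t) (y : ℝ) :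
    ContinuousAt (fun p : ℝ × ℝ => charValue ubar p.1 p.2) (t, y) := by
  have h1 : Tendsto (fun p : ℝ × ℝ => charValue ubar t p.2) (𝓝 (t, y)) (𝓝 (charValue ubar t y)) :=
    ((continuous_charValue hac hw ht).tendsto y).comp (continuous_snd.tendsto (t, y))
  have h2 : Tendsto (fun p : ℝ × ℝ => energy ubar 0 / 4 * |p.1 - t|) (𝓝 (t, y)) (𝓝 0) := by
    have : Continuous fun p : ℝ × ℝ => energy ubar 0 / 4 * |p.1 - t| := by fun_prop
    simpa using this.tendsto (t, y)
  have h3 := (squeeze_zero_norm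
    (fun p : ℝ × ℝ => abs_charValue_sub_time_le hw p.1 t p.2) h2).add h1
  simpa [ContinuousAt] using h3

lemma continuousAt_xi_prod (hac : IsAbsCont ubar)
    (hw : Integrable fun x => deriv ubar x ^ 2) {t : ℝ} (ht : 0 ≤ t) (y : ℝ) :
    ContinuousAt (fun p : ℝ × ℝ => xi ubar p.1 p.2) (t, y) := by
  have h1 : Tendsto (fun p : ℝ × ℝ => xi ubar t p.2 + (p.1 - t) * charValue ubar t p.2)
      (𝓝 (t, y)) (𝓝 (xi ubar t y)) := by
    have := continuous_xi hac hw ht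
    have := continuous_charValue hac hw ht
    have h : Continuous fun p : ℝ × ℝ => xi ubar t p.2 + (p.1 - t) * charValue ubar t p.2 := by
      fun_prop
    simpa using h.tendsto (t, y)
  have h2 : Tendsto (fun p : ℝ × ℝ => energy ubar 0 / 4 * (p.1 - t) ^ 2) (𝓝 (t, y)) (𝓝 0) := by
    have : Continuous fun p : ℝ × ℝ => energy ubar 0 / 4 * (p.1 - t) ^ 2 := by fun_prop
    simpa using this.tendsto (t, y)
  have h3 := (squeeze_zero_norm (fun p : ℝ × ℝ => abs_xi_sub_sub_le hw p.1 t p.2) h2).add h1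
  simpa [ContinuousAt] using h3

/-- Characteristics stay close to the identity, uniformly on bounded time intervals: `ū` grows
at most like a square root, so `T |ū(y)|` is at most `|y| / 2` up to a constant. -/
lemma exists_abs_xi_sub_le (hac : IsAbsCont ubar) (hw : Integrable fun x => deriv ubar x ^ 2)
    {T : ℝ} (hT : 0 ≤ T) : ∃ C, ∀ t ∈ Icc 0 T, ∀ y, |xi ubar t y - y| ≤ |y| / 2 + C := by
  have hE := energy_nonneg (ubar := ubar) 0
  -- Young's coefficient `(T + 1) / 2` at time `0` bounds `T |ū(y) - ū(0)|` by `|y| / 2 + const`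
  refine ⟨T * (|ubar 0| + (T + 1) / 2 * energy ubar 0) + T * (energy ubar 0 / 4) * T,
    fun t ht y => ?_⟩
  have h1 : |∫ s in (0 : ℝ)..t, (t - s) * phi ubar s y| ≤ T * (energy ubar 0 / 4) * T := by
    have h2 : |∫ s in (0 : ℝ)..t, (t - s) * phi ubar s y| ≤
        t * (energy ubar 0 / 4) * |t - 0| := by
      rw [← Real.norm_eq_abs]
      refine intervalIntegral.norm_integral_le_of_norm_le_const fun r hr => ?_
      rw [uIoc_of_le ht.1] at hr
      rw [Real.norm_eq_abs, abs_mul, abs_of_nonneg (sub_nonneg.2 hr.2)]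
      exact mul_le_mul (by linarith [hr.1]) (abs_phi_le hw r y) (abs_nonneg _) ht.1
    rw [sub_zero, abs_of_nonneg ht.1] at h2
    exact h2.trans (mul_le_mul (mul_le_mul_of_nonneg_right ht.2 (by positivity)) ht.2 ht.1
      (by positivity))
  have h3 : |ubar y - ubar 0| ≤ (T + 1) / 2 * energy ubar 0 + |y| / (4 * ((T + 1) / 2)) := by
    have hε : 0 < (T + 1) / 2 := by linarith
    rcases le_total 0 y with hy | hy
    · have h4 := abs_charValue_sub_le hac hw le_rfl hy hε
      simp only [charValue_zero, xi_zero] at h4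
      rw [abs_of_nonneg hy]
      have := mul_le_mul_of_nonneg_left (integral_sq_le_energy hw hy) hε.le
      rw [sub_zero] at h4
      linarith
    · have h4 := abs_charValue_sub_le hac hw le_rfl hy hε
      simp only [charValue_zero, xi_zero] at h4
      rw [abs_of_nonpos hy, abs_sub_comm]
      have := mul_le_mul_of_nonneg_left (integral_sq_le_energy hw hy) hε.le
      rw [zero_sub] at h4
      linarith
  have h4 : T * (|y| / (4 * ((T + 1) / 2))) ≤ |y| / 2 := by
    rw [mul_div_assoc', div_le_div_iff₀ (by linarith) (by norm_num)]
    nlinarith [abs_nonneg y]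
  have h5 : |ubar y| ≤ |ubar 0| + |ubar y - ubar 0| := by
    have := abs_add_le (ubar 0) (ubar y - ubar 0)
    rwa [add_sub_cancel] at this
  have h6 : |xi ubar t y - y| ≤ t * |ubar y| + |∫ s in (0 : ℝ)..t, (t - s) * phi ubar s y| := by
    have h7 : xi ubar t y - y = t * ubar y + ∫ s in (0 : ℝ)..t, (t - s) * phi ubar s y := by
      simp only [xi]; ring
    rw [h7]
    refine (abs_add_le _ _).trans ?_
    rw [abs_mul, abs_of_nonneg ht.1]
  have h7 : t * |ubar y| ≤ T * (|ubar 0| + ((T + 1) / 2 * energy ubar 0 +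
      |y| / (4 * ((T + 1) / 2)))) :=
    mul_le_mul ht.2 (by linarith) (abs_nonneg _) hT
  rw [← add_assoc, mul_add] at h7
  linarith

lemma surjective_xi (hac : IsAbsCont ubar) (hw : Integrable fun x => deriv ubar x ^ 2)
    {t : ℝ} (ht : 0 ≤ t) : Function.Surjective (xi ubar t) := by
  obtain ⟨C, hC⟩ := exists_abs_xi_sub_le hac hw ht
  have hC := hC t ⟨ht, le_rfl⟩
  refine (continuous_xi hac hw ht).surjective ?_ ?_
  · refine tendsto_atTop_mono' atTop (f₁ := fun y => y * (1 / 2) + -C) ?_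
      (tendsto_atTop_add_const_right _ _
        (tendsto_id.atTop_mul_const (r := (1 / 2 : ℝ)) (by norm_num)))
    filter_upwards [eventually_ge_atTop 0] with y hy
    have := (abs_le.1 (hC y)).1
    rw [abs_of_nonneg hy] at this
    linarith
  · refine tendsto_atBot_mono' atBot (f₁ := fun y => y * (1 / 2) + C) ?_
      (tendsto_atBot_add_const_right _ _
        (tendsto_id.atBot_mul_const (r := (1 / 2 : ℝ)) (by norm_num)))
    filter_upwards [eventually_le_atBot 0] with y hy
    have := (abs_le.1 (hC y)).2
    rw [abs_of_nonpos hy] at this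
    linarith

/-! ### The change of variables `x = ξ(t,y)` -/

/-- The measure `ξ_y dy` on particles; `ξ(t,·)` transports it to the Lebesgue measure. -/
def particleMeasure (ubar : ℝ → ℝ) (t : ℝ) : Measure ℝ :=
  volume.withDensity fun y => ENNReal.ofReal (stretch ubar t y ^ 2)

lemma measurable_ofReal_stretch_sq (t : ℝ) :
    Measurable fun y => ENNReal.ofReal (stretch ubar t y ^ 2) :=
  ((measurable_stretch t).pow_const 2).ennreal_ofReal

lemma map_xi_particleMeasure (hac : IsAbsCont ubar)
    (hw : Integrable fun x => deriv ubar x ^ 2) {t : ℝ} (ht : 0 ≤ t) :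
    (particleMeasure ubar t).map (xi ubar t) = volume := by
  have hmono := monotone_xi hac hw ht
  have hcont := continuous_xi hac hw ht
  have hsurj := surjective_xi hac hw ht
  -- the upper adjoint of the monotone map `ξ(t,·)`
  have hgr : ∀ x, ∃ m, xi ubar t m = x ∧ ∀ y, xi ubar t y ≤ x ↔ y ≤ m := by
    intro x
    obtain ⟨y₀, hy₀⟩ := hsurj x
    obtain ⟨y₁, hy₁⟩ := hsurj (x + 1)
    have hbdd : BddAbove {y | xi ubar t y ≤ x} := by
      refine ⟨y₁, fun y hy => ?_⟩
      by_contra! h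
      have h1 := hmono h.le
      have h2 : xi ubar t y ≤ x := hy
      linarith
    have hclosed : IsClosed {y | xi ubar t y ≤ x} := isClosed_le hcont continuous_const
    have hmem : xi ubar t (sSup {y | xi ubar t y ≤ x}) ≤ x :=
      hclosed.csSup_mem ⟨y₀, hy₀.le⟩ hbdd
    refine ⟨sSup {y | xi ubar t y ≤ x}, le_antisymm hmem ?_, fun y => ⟨fun h => ?_, fun h => ?_⟩⟩
    · exact hy₀.ge.trans (hmono (le_csSup hbdd hy₀.le))
    · exact le_csSup hbdd h
    · exact (hmono h).trans hmem
  symm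
  refine Measure.ext_of_Ioc _ _ fun a b hab => ?_
  obtain ⟨m, hm, hm'⟩ := hgr a
  obtain ⟨n, hn, hn'⟩ := hgr b
  have hmn : m ≤ n := (hn' m).1 (by rw [hm]; exact hab.le)
  have hpre : xi ubar t ⁻¹' Ioc a b = Ioc m n := by
    ext y
    simp only [mem_preimage, mem_Ioc, hn', ← not_le, hm']
  rw [Measure.map_apply hcont.measurable measurableSet_Ioc, hpre, particleMeasure,
    withDensity_apply _ measurableSet_Ioc, ← ofReal_integral_eq_lintegral_ofReal
    (intervalIntegrable_stretch_sq hw ht m n).1 (ae_of_all _ fun y => sq_nonneg _),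
    ← intervalIntegral.integral_of_le hmn, ← xi_sub_xi hac hw ht hmn, hm, hn, Real.volume_Ioc]

/-- A Lebesgue-null set of positions is met by almost no particle that is still alive. -/
lemma ae_comp_xi (hac : IsAbsCont ubar) (hw : Integrable fun x => deriv ubar x ^ 2) {t : ℝ}
    (ht : 0 ≤ t) {P : ℝ → Prop} (hP : ∀ᵐ x, P x) :
    ∀ᵐ y, y ∈ aliveSet ubar t → P (xi ubar t y) := by
  rw [← map_xi_particleMeasure hac hw ht] at hP
  have h1 := ae_of_ae_map (continuous_xi hac hw ht).measurable.aemeasurable hP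
  rw [particleMeasure, ae_withDensity_iff (measurable_ofReal_stretch_sq t)] at h1
  filter_upwards [h1] with y hy hy'
  refine hy ?_
  have := (mem_aliveSet_iff_stretch_pos ht y).1 hy'
  rw [Ne, ENNReal.ofReal_eq_zero, not_le]
  positivity

lemma integrable_comp_xi_iff (hac : IsAbsCont ubar) (hw : Integrable fun x => deriv ubar x ^ 2)
    {t : ℝ} (ht : 0 ≤ t) {g : ℝ → ℝ} (hg : Measurable g) :
    Integrable g ↔ Integrable fun y => stretch ubar t y ^ 2 * g (xi ubar t y) := by
  conv_lhs => rw [← map_xi_particleMeasure hac hw ht]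
  rw [integrable_map_measure hg.aestronglyMeasurable
    (continuous_xi hac hw ht).measurable.aemeasurable, particleMeasure,
    integrable_withDensity_iff_integrable_smul' (measurable_ofReal_stretch_sq t)
    (ae_of_all _ fun y => ENNReal.ofReal_lt_top)]
  simp [ENNReal.toReal_ofReal (sq_nonneg _)]

lemma integral_comp_xi (hac : IsAbsCont ubar) (hw : Integrable fun x => deriv ubar x ^ 2)
    {t : ℝ} (ht : 0 ≤ t) {g : ℝ → ℝ} (hg : Measurable g) :
    ∫ x, g x = ∫ y, stretch ubar t y ^ 2 * g (xi ubar t y) := by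
  conv_lhs => rw [← map_xi_particleMeasure hac hw ht]
  rw [integral_map (continuous_xi hac hw ht).measurable.aemeasurable hg.aestronglyMeasurable,
    particleMeasure, integral_withDensity_eq_integral_toReal_smul (measurable_ofReal_stretch_sq t)
    (ae_of_all _ fun y => ENNReal.ofReal_lt_top)]
  simp [ENNReal.toReal_ofReal (sq_nonneg _)]

/-! ### Profiles carried by the characteristics -/

/-- The profile of the solution at time `t` is absolutely continuous: over disjoint intervals,
Young's inequality bounds the total increment by a small part of the energy plus a multiple of the
total length. -/
lemma isAbsCont_profile (hac : IsAbsCont ubar) (hw : Integrable fun x => deriv ubar x ^ 2)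
    {t : ℝ} (ht : 0 ≤ t) {p : ℝ → ℝ} (hp : ∀ y, p (xi ubar t y) = charValue ubar t y) :
    IsAbsCont p := by
  intro a b
  -- a right inverse of `ξ(t,·)`, which turns disjoint intervals into disjoint intervals
  obtain ⟨η, hη⟩ := (surjective_xi hac hw ht).hasRightInverse
  have hmono := monotone_xi hac hw ht
  have hηm : Monotone η := by
    intro x x' h
    by_contra! h'
    have h1 := hmono h'.le
    rw [hη, hη] at h1
    obtain rfl := le_antisymm h h1
    exact lt_irrefl _ h'
  have hkey : ∀ k > 0, ∀ x x' : ℝ, dist (p x) (p x') ≤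
      k * (∫ y in uIoc (η x) (η x'), deriv ubar y ^ 2) + dist x x' / (4 * k) := by
    intro k hk x x'
    wlog h : x ≤ x' generalizing x x'
    · rw [dist_comm, dist_comm x, uIoc_comm]
      exact this x' x (le_of_not_ge h)
    have h1 := abs_charValue_sub_le hac hw ht (hηm h) hk
    rw [← hp, ← hp, hη, hη, intervalIntegral.integral_of_le (hηm h)] at h1
    rwa [dist_comm, dist_comm x, Real.dist_eq, Real.dist_eq, uIoc_of_le (hηm h),
      abs_of_nonneg (sub_nonneg.2 h)]
  have hE := energy_nonneg (ubar := ubar) 0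
  rw [absolutelyContinuousOnInterval_iff]
  intro ε hε
  -- half of `ε` goes to the energy, and the choice of `δ` leaves the other half to the length
  set k := ε / (2 * (energy ubar 0 + 1)) with hkdef
  have hk : 0 < k := by positivity
  refine ⟨2 * k * ε, by positivity, fun I hI hlen => ?_⟩
  have hdisj : (Finset.range I.1 : Set ℕ).Pairwise
      (Function.onFun Disjoint fun i => uIoc (η (I.2 i).1) (η (I.2 i).2)) := by
    intro i hi j hj hij
    have h1 : Disjoint (uIoc (I.2 i).1 (I.2 i).2) (uIoc (I.2 j).1 (I.2 j).2) := hI.2 hi hj hij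
    rw [uIoc, uIoc, Ioc_disjoint_Ioc] at h1
    have h2 := hηm h1
    rw [hηm.map_min, hηm.map_max, hηm.map_max, hηm.map_max, hηm.map_min, hηm.map_min] at h2
    rw [Function.onFun, uIoc, uIoc, Ioc_disjoint_Ioc]
    exact h2
  have hsum : ∑ i ∈ Finset.range I.1, ∫ y in uIoc (η (I.2 i).1) (η (I.2 i).2),
      deriv ubar y ^ 2 ≤ energy ubar 0 := by
    rw [← integral_biUnion_finset _ (fun i _ => measurableSet_uIoc) hdisj
      (fun i _ => hw.integrableOn), energy_zero]
    exact setIntegral_le_integral hw (ae_of_all _ fun _ => sq_nonneg _)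
  calc ∑ i ∈ Finset.range I.1, dist (p (I.2 i).1) (p (I.2 i).2)
      ≤ ∑ i ∈ Finset.range I.1, (k * (∫ y in uIoc (η (I.2 i).1) (η (I.2 i).2),
          deriv ubar y ^ 2) + dist (I.2 i).1 (I.2 i).2 / (4 * k)) :=
        Finset.sum_le_sum fun i _ => hkey k hk _ _
    _ = k * (∑ i ∈ Finset.range I.1, ∫ y in uIoc (η (I.2 i).1) (η (I.2 i).2),
          deriv ubar y ^ 2) + (∑ i ∈ Finset.range I.1, dist (I.2 i).1 (I.2 i).2) / (4 * k) := by
        rw [Finset.sum_add_distrib, Finset.mul_sum, Finset.sum_div]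
    _ < ε / 2 + ε / 2 := by
        refine add_lt_add_of_le_of_lt ?_ ?_
        · calc _ ≤ k * energy ubar 0 := by gcongr
            _ ≤ k * (energy ubar 0 + 1) := by gcongr; linarith
            _ = ε / 2 := by rw [hkdef]; field_simp
        · rw [div_lt_iff₀ (by positivity)]
          linarith
    _ = ε := by ring

lemma IsAbsCont.ae_differentiableAt {p : ℝ → ℝ} (h : IsAbsCont p) :
    ∀ᵐ x, DifferentiableAt ℝ p x := by
  have h1 : ∀ᵐ x, ∀ n : ℕ, x ∈ uIcc (-(n : ℝ)) n → DifferentiableAt ℝ p x :=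
    ae_all_iff.2 fun n => (h _ _).ae_differentiableAt
  filter_upwards [h1] with x hx
  obtain ⟨n, hn⟩ := exists_nat_ge |x|
  refine hx n ?_
  rw [uIcc_of_le (by linarith [abs_nonneg x])]
  exact abs_le.1 hn

lemma IsAbsCont.continuous {p : ℝ → ℝ} (h : IsAbsCont p) : Continuous p := by
  refine continuous_iff_continuousAt.2 fun x => ?_
  refine (h (x - 1) (x + 1)).continuousOn.continuousAt ?_
  rw [uIcc_of_le (by linarith)]
  exact Icc_mem_nhds (by linarith) (by linarith)

lemma locallyIntegrable_of_intervalIntegrable {f : ℝ → ℝ}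
    (h : ∀ a b, IntervalIntegrable f volume a b) : LocallyIntegrable f := fun x =>
  ⟨Ioc (x - 1) (x + 1), Ioc_mem_nhds (by linarith) (by linarith), (h _ _).1⟩

lemma ae_hasDerivAt_xi_space (hac : IsAbsCont ubar)
    (hw : Integrable fun x => deriv ubar x ^ 2) {t : ℝ} (ht : 0 ≤ t) :
    ∀ᵐ y, HasDerivAt (xi ubar t) (stretch ubar t y ^ 2) y := by
  filter_upwards [LocallyIntegrable.ae_hasDerivAt_integral
    (locallyIntegrable_of_intervalIntegrable fun a b =>
      intervalIntegrable_stretch_sq hw ht a b)] with y hy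
  rw [xi_eq_add_integral hac hw ht]
  exact (hy 0).const_add _

lemma ae_hasDerivAt_charValue_space (hac : IsAbsCont ubar)
    (hw : Integrable fun x => deriv ubar x ^ 2) {t : ℝ} (ht : 0 ≤ t) :
    ∀ᵐ y, HasDerivAt (charValue ubar t) (deriv ubar y * stretch ubar t y) y := by
  filter_upwards [LocallyIntegrable.ae_hasDerivAt_integral
    (locallyIntegrable_of_intervalIntegrable fun a b =>
      intervalIntegrable_deriv_mul_stretch hac hw ht a b)] with y hy
  rw [charValue_eq_add_integral hac hw ht]
  exact (hy 0).const_add _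

/-- The gradient of the profile along the characteristics, from the chain rule. -/
lemma ae_deriv_profile_mul_stretch (hac : IsAbsCont ubar)
    (hw : Integrable fun x => deriv ubar x ^ 2) {t : ℝ} (ht : 0 ≤ t) {p : ℝ → ℝ}
    (hp : ∀ y, p (xi ubar t y) = charValue ubar t y) :
    ∀ᵐ y, y ∈ aliveSet ubar t → deriv p (xi ubar t y) * stretch ubar t y = deriv ubar y := by
  filter_upwards [ae_comp_xi hac hw ht (isAbsCont_profile hac hw ht hp).ae_differentiableAt,
    ae_hasDerivAt_xi_space hac hw ht, ae_hasDerivAt_charValue_space hac hw ht] with y h1 h2 h3 hy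
  have h4 := (h1 hy).hasDerivAt.comp y h2
  have h5 : p ∘ xi ubar t = charValue ubar t := funext hp
  rw [h5] at h4
  have h6 := h4.unique h3
  have h7 := (mem_aliveSet_iff_stretch_pos ht y).1 hy
  refine mul_right_cancel₀ h7.ne' ?_
  rw [← h6]; ring

lemma ae_stretch_sq_mul_deriv_profile_sq (hac : IsAbsCont ubar)
    (hw : Integrable fun x => deriv ubar x ^ 2) {t : ℝ} (ht : 0 ≤ t) {p : ℝ → ℝ}
    (hp : ∀ y, p (xi ubar t y) = charValue ubar t y) :
    ∀ᵐ y, stretch ubar t y ^ 2 * deriv p (xi ubar t y) ^ 2 =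
      (aliveSet ubar t).indicator (fun y => deriv ubar y ^ 2) y := by
  filter_upwards [ae_deriv_profile_mul_stretch hac hw ht hp] with y h1
  by_cases h : y ∈ aliveSet ubar t
  · rw [indicator_of_mem h, ← h1 h]; ring
  · rw [indicator_of_notMem h, stretch_eq_zero ht h]; ring

lemma integrable_deriv_profile_sq (hac : IsAbsCont ubar)
    (hw : Integrable fun x => deriv ubar x ^ 2) {t : ℝ} (ht : 0 ≤ t) {p : ℝ → ℝ}
    (hp : ∀ y, p (xi ubar t y) = charValue ubar t y) : Integrable fun x => deriv p x ^ 2 := by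
  rw [integrable_comp_xi_iff hac hw ht ((measurable_deriv p).pow_const 2)]
  exact (hw.indicator (measurableSet_aliveSet t)).congr
    ((ae_stretch_sq_mul_deriv_profile_sq hac hw ht hp).mono fun y hy => hy.symm)

/-- The energy density of the profile is the image of the energy density of the particles that
are alive. -/
lemma integral_deriv_profile_sq_mul (hac : IsAbsCont ubar)
    (hw : Integrable fun x => deriv ubar x ^ 2) {t : ℝ} (ht : 0 ≤ t) {p : ℝ → ℝ}
    (hp : ∀ y, p (xi ubar t y) = charValue ubar t y) {g : ℝ → ℝ} (hg : Measurable g) :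
    ∫ x, deriv p x ^ 2 * g x = ∫ y in aliveSet ubar t, deriv ubar y ^ 2 * g (xi ubar t y) := by
  rw [integral_comp_xi hac hw ht (g := fun x => deriv p x ^ 2 * g x)
    (((measurable_deriv p).pow_const 2).mul hg),
    ← integral_indicator (measurableSet_aliveSet t)]
  refine integral_congr_ae ?_
  filter_upwards [ae_stretch_sq_mul_deriv_profile_sq hac hw ht hp] with y hy
  rw [← mul_assoc, hy]
  by_cases h : y ∈ aliveSet ubar t <;> simp [h]

lemma integral_deriv_profile_sq (hac : IsAbsCont ubar)
    (hw : Integrable fun x => deriv ubar x ^ 2) {t : ℝ} (ht : 0 ≤ t) {p : ℝ → ℝ}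
    (hp : ∀ y, p (xi ubar t y) = charValue ubar t y) :
    ∫ x, deriv p x ^ 2 = energy ubar t := by
  simpa [energy] using integral_deriv_profile_sq_mul hac hw ht hp (measurable_const (a := (1 : ℝ)))

lemma memLp_deriv_profile (hac : IsAbsCont ubar)
    (hw : Integrable fun x => deriv ubar x ^ 2) {t : ℝ} (ht : 0 ≤ t) {p : ℝ → ℝ}
    (hp : ∀ y, p (xi ubar t y) = charValue ubar t y) : MemLp (deriv p) 2 :=
  (memLp_two_iff_integrable_sq (measurable_deriv p).aestronglyMeasurable).2
    (integrable_deriv_profile_sq hac hw ht hp)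

/-- The source of the equation at the position of a particle depends only on the particles ahead
and behind: those sharing its position carry no energy. -/
lemma source_profile (hac : IsAbsCont ubar)
    (hw : Integrable fun x => deriv ubar x ^ 2) {t : ℝ} (ht : 0 ≤ t) {p : ℝ → ℝ}
    (hp : ∀ y, p (xi ubar t y) = charValue ubar t y) (y : ℝ) :
    source p (xi ubar t y) = phi ubar t y := by
  have hq := integrable_deriv_profile_sq hac hw ht hp
  have h1 : (∫ z in Iic (xi ubar t y), deriv p z ^ 2) - (∫ z in Ioi (xi ubar t y), deriv p z ^ 2) =
      ∫ z, deriv p z ^ 2 * Real.sign (xi ubar t y - z) := by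
    rw [← integral_indicator measurableSet_Iic, ← integral_indicator measurableSet_Ioi,
      ← integral_sub (hq.indicator measurableSet_Iic) (hq.indicator measurableSet_Ioi)]
    refine integral_congr_ae ?_
    filter_upwards [(countable_singleton (xi ubar t y)).ae_notMem volume] with z hz
    rcases lt_or_gt_of_ne hz with h | h
    · have h2 : z ∈ Iic (xi ubar t y) := h.le
      have h3 : z ∉ Ioi (xi ubar t y) := h.not_gt
      simp [h2, h3, Real.sign_of_pos (sub_pos.2 h)]
    · have h2 : z ∉ Iic (xi ubar t y) := h.not_ge
      have h3 : z ∈ Ioi (xi ubar t y) := h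
      simp [h2, h3, Real.sign_of_neg (sub_neg.2 h)]
  rw [source, h1, integral_deriv_profile_sq_mul hac hw ht hp (measurable_sign_sub _), phi]
  congr 1
  refine setIntegral_congr_ae (measurableSet_aliveSet t) ?_
  filter_upwards [ae_comp_xi hac hw ht
    ((countable_singleton (xi ubar t y)).ae_notMem volume)] with z hz hz'
  have hne : xi ubar t z ≠ xi ubar t y := hz hz'
  rw [mul_comm]
  congr 1
  have hmono := monotone_xi hac hw ht
  rcases lt_or_gt_of_ne hne with h | h
  · have h2 : z < y := hmono.reflect_lt h
    rw [Real.sign_of_pos (sub_pos.2 h), Real.sign_of_pos (sub_pos.2 h2)]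
  · have h2 : y < z := hmono.reflect_lt h
    rw [Real.sign_of_neg (sub_neg.2 h), Real.sign_of_neg (sub_neg.2 h2)]

/-! ### Local averages in `L²` -/

lemma eLpNorm_two_sq {α : Type*} [MeasurableSpace α] (f : α → ℝ) (μ : Measure α) :
    eLpNorm f 2 μ ^ 2 = ∫⁻ x, ‖f x‖ₑ ^ 2 ∂μ := by
  have h := eLpNorm_nnreal_pow_eq_lintegral (μ := μ) (f := f) (p := 2) (by norm_num)
  simpa using h

/-- The mass `∫_{x-r}^{x+r} |q|` of `q` near `x`. -/
def localMass (q : ℝ → ℝ) (r x : ℝ) : ℝ := ∫ z in (x - r)..(x + r), |q z|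

lemma localMass_eq (q : ℝ → ℝ) (r x : ℝ) :
    localMass q r x = ∫ z in (-r)..r, |q (x + z)| := by
  rw [intervalIntegral.integral_comp_add_left (fun z => |q z|) x, localMass, sub_eq_add_neg]

lemma intervalIntegrable_of_memLp_two {q : ℝ → ℝ} (hq : MemLp q 2) (a b : ℝ) :
    IntervalIntegrable q volume a b :=
  ((hq.locallyIntegrable (by norm_num)).integrableOn_isCompact isCompact_uIcc).intervalIntegrable

lemma continuous_localMass {q : ℝ → ℝ} (hq : MemLp q 2) (r : ℝ) :
    Continuous (localMass q r) := by
  have h : ∀ a b, IntervalIntegrable (fun z => |q z|) volume a b := fun a b =>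
    (intervalIntegrable_of_memLp_two hq a b).abs
  have h1 : localMass q r = fun x => (∫ z in (0 : ℝ)..(x + r), |q z|) -
      ∫ z in (0 : ℝ)..(x - r), |q z| := by
    funext x
    rw [localMass, intervalIntegral.integral_interval_sub_left (h _ _) (h _ _)]
  have h2 := intervalIntegral.continuous_primitive h 0
  rw [h1]
  exact (h2.comp (continuous_id.add continuous_const)).sub
    (h2.comp (continuous_id.sub continuous_const))

lemma abs_integral_le_localMass {q : ℝ → ℝ} (hq : MemLp q 2) {r x x' : ℝ}
    (h : |x' - x| ≤ r) : |∫ z in x..x', q z| ≤ localMass q r x := by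
  have hr : 0 ≤ r := (abs_nonneg _).trans h
  have h' := abs_le.1 h
  have h1 : |∫ z in x..x', q z| ≤ ∫ z in uIoc x x', |q z| := by
    simpa using intervalIntegral.norm_integral_le_integral_norm_uIoc (f := q) (a := x) (b := x')
      (μ := volume)
  refine h1.trans ?_
  rw [localMass, intervalIntegral.integral_of_le (by linarith)]
  refine setIntegral_mono_set (intervalIntegrable_of_memLp_two hq _ _).1.abs
    (ae_of_all _ fun _ => abs_nonneg _) (LE.le.eventuallyLE ?_)
  rw [uIoc]
  refine Ioc_subset_Ioc ?_ ?_
  · exact le_min (by linarith) (by linarith)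
  · exact max_le (by linarith) (by linarith)

/-- By the Cauchy–Schwarz inequality and Tonelli's theorem, averaging over a window of half-width
`r` costs a factor `2r` in `L²`. -/
lemma eLpNorm_localMass_le {q : ℝ → ℝ} (hqm : Measurable q) {r : ℝ} (hr : 0 ≤ r) :
    eLpNorm (localMass q r) 2 volume ≤ ENNReal.ofReal (2 * r) * eLpNorm q 2 volume := by
  have hvol : volume (Ioc (-r) r) = ENNReal.ofReal (2 * r) := by
    rw [Real.volume_Ioc]; congr 1; ring
  have h1 : ∀ x, ‖localMass q r x‖ₑ ^ 2 ≤
      ENNReal.ofReal (2 * r) * ∫⁻ z in Ioc (-r) r, ‖q (x + z)‖ₑ ^ 2 := by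
    intro x
    have h2 : ‖localMass q r x‖ₑ ≤
        eLpNorm (fun z => q (x + z)) 1 (volume.restrict (Ioc (-r) r)) := by
      rw [localMass_eq, intervalIntegral.integral_of_le (by linarith),
        eLpNorm_one_eq_lintegral_enorm]
      refine (enorm_integral_le_lintegral_enorm _).trans (le_of_eq ?_)
      simp
    have h3 := eLpNorm_le_eLpNorm_mul_rpow_measure_univ (p := 1) (q := 2)
      (μ := volume.restrict (Ioc (-r) r)) (f := fun z => q (x + z)) (by norm_num)
      (hqm.comp (measurable_const_add x)).aestronglyMeasurable
    rw [Measure.restrict_apply_univ, hvol] at h3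
    calc ‖localMass q r x‖ₑ ^ 2
        ≤ (eLpNorm (fun z => q (x + z)) 2 (volume.restrict (Ioc (-r) r)) *
          ENNReal.ofReal (2 * r) ^ (1 / (1 : ENNReal).toReal - 1 / (2 : ENNReal).toReal)) ^ 2 := by
          gcongr
          exact h2.trans h3
      _ = ENNReal.ofReal (2 * r) * ∫⁻ z in Ioc (-r) r, ‖q (x + z)‖ₑ ^ 2 := by
          rw [mul_pow, eLpNorm_two_sq, mul_comm, ← ENNReal.rpow_natCast, ← ENNReal.rpow_mul]
          norm_num
  have h4 : eLpNorm (localMass q r) 2 volume ^ 2 ≤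
      (ENNReal.ofReal (2 * r) * eLpNorm q 2 volume) ^ 2 := by
    rw [mul_pow, eLpNorm_two_sq, eLpNorm_two_sq]
    calc ∫⁻ x, ‖localMass q r x‖ₑ ^ 2
        ≤ ∫⁻ x, ENNReal.ofReal (2 * r) * ∫⁻ z in Ioc (-r) r, ‖q (x + z)‖ₑ ^ 2 :=
          lintegral_mono h1
      _ = ENNReal.ofReal (2 * r) * ∫⁻ z in Ioc (-r) r, ∫⁻ x, ‖q (x + z)‖ₑ ^ 2 := by
          rw [lintegral_const_mul' _ _ ENNReal.ofReal_ne_top, lintegral_lintegral_swap]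
          exact ((hqm.comp (measurable_fst.add measurable_snd)).enorm.pow_const 2).aemeasurable
      _ = ENNReal.ofReal (2 * r) ^ 2 * ∫⁻ x, ‖q x‖ₑ ^ 2 := by
          simp_rw [lintegral_add_right_eq_self (fun x => ‖q x‖ₑ ^ 2)]
          rw [lintegral_const, Measure.restrict_apply_univ, hvol]
          ring
  exact (ENNReal.pow_le_pow_left_iff two_ne_zero).1 h4

/-! ### Strong convergence in a Hilbert space -/

/-- Convergence of the norms together with weak convergence against a dense set implies strong
convergence. -/
lemma tendsto_of_tendsto_norm_of_tendsto_inner {H ι : Type*} [NormedAddCommGroup H]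
    [InnerProductSpace ℝ H] {l : Filter ι} {Q : ι → H} {Q₀ : H} {S : Set H}
    (hS : ∀ ε > 0, ∃ g ∈ S, ‖Q₀ - g‖ < ε)
    (hn : Tendsto (fun i => ‖Q i‖) l (𝓝 ‖Q₀‖))
    (hi : ∀ g ∈ S, Tendsto (fun i => inner ℝ (Q i) g) l (𝓝 (inner ℝ Q₀ g))) :
    Tendsto Q l (𝓝 Q₀) := by
  rw [Metric.tendsto_nhds]
  intro ε hε
  obtain ⟨g, hg, hg'⟩ := hS (ε / 2) (by linarith)
  have h1 : Tendsto (fun i => ‖Q i - g‖ ^ 2) l (𝓝 (‖Q₀ - g‖ ^ 2)) := by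
    simp_rw [norm_sub_sq_real]
    exact ((hn.pow 2).sub ((hi g hg).const_mul 2)).add_const _
  have h2 : ‖Q₀ - g‖ ^ 2 < (ε / 2) ^ 2 := by gcongr
  filter_upwards [h1.eventually_lt_const h2] with i hi'
  have h3 : ‖Q i - g‖ < ε / 2 := lt_of_pow_lt_pow_left₀ 2 (by linarith) hi'
  calc dist (Q i) Q₀ ≤ dist (Q i) g + dist g Q₀ := dist_triangle _ _ _
    _ < ε / 2 + ε / 2 := by
        rw [dist_eq_norm, dist_comm, dist_eq_norm]
        exact add_lt_add h3 hg'
    _ = ε := by ring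

/-! ### Continuity of the solution -/

lemma abs_profile_sub_le (hac : IsAbsCont ubar) (hw : Integrable fun x => deriv ubar x ^ 2)
    {t : ℝ} (ht : 0 ≤ t) {p : ℝ → ℝ} (hp : ∀ y, p (xi ubar t y) = charValue ubar t y) {ε : ℝ}
    (hε : 0 < ε) (x x' : ℝ) : |p x - p x'| ≤ ε * energy ubar 0 + |x - x'| / (4 * ε) := by
  obtain ⟨y, rfl⟩ := surjective_xi hac hw ht x
  obtain ⟨y', rfl⟩ := surjective_xi hac hw ht x'
  wlog h : y' ≤ y generalizing y y'
  · rw [abs_sub_comm, abs_sub_comm (xi ubar t y)]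
    exact this y' y (le_of_not_ge h)
  have h1 := abs_charValue_sub_le hac hw ht h hε
  rw [hp, hp, abs_of_nonneg (sub_nonneg.2 (monotone_xi hac hw ht h))]
  have h2 := mul_le_mul_of_nonneg_left (integral_sq_le_energy hw h) hε.le
  linarith

lemma continuousOn_solution (hac : IsAbsCont ubar) (hw : Integrable fun x => deriv ubar x ^ 2)
    (hu : IsGivenByCharacteristics ubar u) :
    ContinuousOn (Function.uncurry u) (Ici 0 ×ˢ univ) := by
  rintro ⟨t, x⟩ ⟨ht : 0 ≤ t, -⟩
  obtain ⟨y, rfl⟩ := surjective_xi hac hw ht x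
  have hE := energy_nonneg (ubar := ubar) 0
  rw [ContinuousWithinAt, Metric.tendsto_nhds]
  intro ε hε
  set k := ε / (3 * (energy ubar 0 + 1)) with hk'
  have hk : 0 < k := by positivity
  have hkE : k * energy ubar 0 ≤ ε / 3 := by
    rw [hk', div_mul_eq_mul_div, div_le_div_iff₀ (by positivity) (by norm_num)]
    nlinarith
  have hxi := continuous_xi_time hw y
  have hv := continuous_charValue_time hw y
  have h1 : ∀ᶠ p : ℝ × ℝ in 𝓝 (t, xi ubar t y), |p.2 - xi ubar p.1 y| / (4 * k) < ε / 3 := by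
    have h : Continuous fun p : ℝ × ℝ => |p.2 - xi ubar p.1 y| / (4 * k) := by fun_prop
    refine h.continuousAt.eventually_lt_const ?_
    simpa using hε
  have h2 : ∀ᶠ p : ℝ × ℝ in 𝓝 (t, xi ubar t y),
      |charValue ubar p.1 y - charValue ubar t y| < ε / 3 := by
    have h : Continuous fun p : ℝ × ℝ => |charValue ubar p.1 y - charValue ubar t y| := by
      fun_prop
    refine h.continuousAt.eventually_lt_const ?_
    simpa using hε
  filter_upwards [nhdsWithin_le_nhds h1, nhdsWithin_le_nhds h2, self_mem_nhdsWithin] with p h3 h4 h5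
  have h6 := abs_profile_sub_le hac hw h5.1 (hu p.1 h5.1) hk p.2 (xi ubar p.1 y)
  rw [hu p.1 h5.1] at h6
  have h7 := abs_add_le (u p.1 p.2 - charValue ubar p.1 y)
    (charValue ubar p.1 y - charValue ubar t y)
  rw [sub_add_sub_cancel] at h7
  rw [Real.dist_eq, Function.uncurry, Function.uncurry, hu t ht]
  linarith

lemma exists_abs_solution_le (hac : IsAbsCont ubar) (hw : Integrable fun x => deriv ubar x ^ 2)
    (hu : IsGivenByCharacteristics ubar u) (T a b : ℝ) :
    ∃ M, 0 ≤ M ∧ ∀ t ∈ Icc 0 T, ∀ x ∈ Icc a b, |u t x| ≤ M := by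
  have h1 : IsCompact (Icc (0 : ℝ) T ×ˢ Icc a b) := isCompact_Icc.prod isCompact_Icc
  obtain ⟨M, hM⟩ := h1.exists_bound_of_continuousOn
    ((continuousOn_solution hac hw hu).mono (prod_mono Icc_subset_Ici_self (subset_univ _)))
  exact ⟨|M|, abs_nonneg M, fun t ht x hx => (hM (t, x) ⟨ht, hx⟩).trans (le_abs_self M)⟩

lemma exists_abs_le_of_hasCompactSupport {g : ℝ → ℝ} (hg : HasCompactSupport g) :
    ∃ R, ∀ x, g x ≠ 0 → |x| ≤ R := by
  obtain ⟨R, hR⟩ := hg.isCompact.isBounded.exists_norm_le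
  exact ⟨R, fun x hx => hR x (subset_tsupport g hx)⟩

/-- On a bounded time interval, the particles that visit a bounded region of space form a bounded
set. -/
lemma exists_abs_le_of_abs_xi_le (hac : IsAbsCont ubar) (hw : Integrable fun x => deriv ubar x ^ 2)
    {T : ℝ} (hT : 0 ≤ T) (R : ℝ) :
    ∃ B, ∀ t ∈ Icc 0 T, ∀ y, |xi ubar t y| ≤ R → |y| ≤ B := by
  obtain ⟨C, hC⟩ := exists_abs_xi_sub_le hac hw hT
  refine ⟨2 * (R + C), fun t ht y hy => ?_⟩
  have h1 := hC t ht y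
  have h2 := abs_sub_abs_le_abs_sub y (xi ubar t y)
  rw [abs_sub_comm] at h2
  linarith

lemma continuous_integral_particles (hac : IsAbsCont ubar)
    (hw : Integrable fun x => deriv ubar x ^ 2)
    {g : ℝ → ℝ} (hg : Continuous g) (hgc : HasCompactSupport g) :
    Continuous fun t : ℝ => ∫ y, deriv ubar y * stretch ubar (max t 0) y *
      g (xi ubar (max t 0) y) := by
  refine continuous_iff_continuousAt.2 fun t => ?_
  set T := max t 0 + 1
  have hT : 0 ≤ T := by positivity
  obtain ⟨R, hR⟩ := exists_abs_le_of_hasCompactSupport hgc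
  obtain ⟨B, hB⟩ := exists_abs_le_of_abs_xi_le hac hw hT R
  obtain ⟨G, hG⟩ := hgc.exists_bound_of_continuous hg
  have hm := measurable_deriv ubar
  refine continuousAt_of_dominated
    (bound := (Icc (-B) B).indicator fun y => |deriv ubar y| * (1 + T * |deriv ubar y|) * G)
    ?_ ?_ ?_ ?_
  · refine Eventually.of_forall fun s => Measurable.aestronglyMeasurable ?_
    have h1 := measurable_stretch (ubar := ubar) (max s 0)
    have h2 := (continuous_xi hac hw (le_max_right s 0)).measurable
    exact (hm.mul h1).mul (hg.measurable.comp h2)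
  · have h1 : ∀ᶠ s : ℝ in 𝓝 t, max s 0 ≤ T := by
      have h : Continuous fun s : ℝ => max s 0 := by fun_prop
      exact (h.continuousAt.eventually_lt_const (lt_add_one (max t 0))).mono fun s hs => hs.le
    filter_upwards [h1] with s hs
    refine ae_of_all _ fun y => ?_
    by_cases h : g (xi ubar (max s 0) y) = 0
    · rw [h, mul_zero, norm_zero]
      refine indicator_nonneg (fun y _ => ?_) y
      have := (norm_nonneg _).trans (hG 0)
      positivity
    · have h2 := hB _ ⟨le_max_right s 0, hs⟩ y (hR _ h)
      rw [indicator_of_mem (mem_Icc.2 (abs_le.1 h2)), norm_mul, norm_mul, Real.norm_eq_abs,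
        Real.norm_eq_abs (stretch _ _ _), abs_of_nonneg (stretch_nonneg _ _)]
      gcongr
      · exact stretch_le (le_max_right s 0) hs y
      · exact hG _
  · rw [integrable_indicator_iff measurableSet_Icc]
    have h1 : IntegrableOn (deriv ubar) (Icc (-B) B) := by
      rcases le_or_gt (-B) B with h | h
      · exact (intervalIntegrable_iff_integrableOn_Icc_of_le h).1
          (hac (-B) B).intervalIntegrable_deriv
      · simp [Icc_eq_empty h.not_ge]
    have h2 : IntegrableOn (fun y => deriv ubar y ^ 2) (Icc (-B) B) := hw.integrableOn
    refine ((h1.abs.add (h2.const_mul T)).mul_const G).congr (ae_of_all _ fun y => ?_)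
    simp only [Pi.add_apply]
    rw [← sq_abs (deriv ubar y)]
    ring
  · refine ae_of_all _ fun y => ?_
    have h1 := continuous_stretch_time (ubar := ubar) y
    have h2 := continuous_xi_time hw y
    have h : Continuous fun s : ℝ => deriv ubar y * stretch ubar (max s 0) y *
        g (xi ubar (max s 0) y) := by fun_prop
    exact h.continuousAt

lemma antitone_energy_max (hw : Integrable fun x => deriv ubar x ^ 2) :
    Antitone fun s => energy ubar (max s 0) := fun s _ h =>
  energy_antitone hw (le_max_right s 0) (max_le_max_right 0 h)

/-! ### The gradient as a curve in `L²` -/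

/-- The gradient `u_x(t,·)` as an element of `L²(ℝ)`, extended to negative times by its initial
value. -/
def gradLp (hac : IsAbsCont ubar) (hw : Integrable fun x => deriv ubar x ^ 2)
    (hu : IsGivenByCharacteristics ubar u) (t : ℝ) : Lp ℝ 2 (volume : Measure ℝ) :=
  (memLp_deriv_profile hac hw (le_max_right t 0) (hu _ (le_max_right t 0))).toLp

lemma norm_gradLp_sq (hac : IsAbsCont ubar)
    (hw : Integrable fun x => deriv ubar x ^ 2) (hu : IsGivenByCharacteristics ubar u)
    (t : ℝ) : ‖gradLp hac hw hu t‖ ^ 2 = energy ubar (max t 0) := by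
  rw [← integral_deriv_profile_sq hac hw (le_max_right t 0) (hu _ (le_max_right t 0)),
    ← real_inner_self_eq_norm_sq, L2.inner_def]
  refine integral_congr_ae ?_
  filter_upwards [MemLp.coeFn_toLp (memLp_deriv_profile hac hw (le_max_right t 0)
    (hu _ (le_max_right t 0)))] with x hx
  rw [gradLp, hx]
  simp [sq]

/-- Against a continuous function with compact support, the gradient tests like
`ū_x (1 + t ū_x / 2)₊` on particles, which depends continuously on time. -/
lemma inner_gradLp (hac : IsAbsCont ubar)
    (hw : Integrable fun x => deriv ubar x ^ 2) (hu : IsGivenByCharacteristics ubar u)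
    {g : ℝ → ℝ} (hg : Continuous g) (hg2 : MemLp g 2) (t : ℝ) :
    inner ℝ (gradLp hac hw hu t) (hg2.toLp g) = ∫ y, deriv ubar y *
      stretch ubar (max t 0) y * g (xi ubar (max t 0) y) := by
  have ht := le_max_right t 0
  have h1 : inner ℝ (gradLp hac hw hu t) (hg2.toLp g) =
      ∫ x, deriv (u (max t 0)) x * g x := by
    rw [L2.inner_def]
    refine integral_congr_ae ?_
    filter_upwards [MemLp.coeFn_toLp (memLp_deriv_profile hac hw ht (hu _ ht)),
      hg2.coeFn_toLp] with x hx hx'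
    rw [gradLp, hx, hx']
    simp [mul_comm]
  rw [h1, integral_comp_xi hac hw ht (g := fun x => deriv (u (max t 0)) x * g x)
    ((measurable_deriv _).mul hg.measurable)]
  refine integral_congr_ae ?_
  filter_upwards [ae_deriv_profile_mul_stretch hac hw ht (hu _ ht)] with y hy
  by_cases h : y ∈ aliveSet ubar (max t 0)
  · rw [← hy h]; ring
  · simp [stretch_eq_zero ht h]

/-- The gradient is strongly continuous in `L²` at the times where the energy is continuous. -/
lemma continuousAt_gradLp (hac : IsAbsCont ubar)
    (hw : Integrable fun x => deriv ubar x ^ 2) (hu : IsGivenByCharacteristics ubar u)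
    {t : ℝ} (hc : ContinuousAt (fun s => energy ubar (max s 0)) t) :
    ContinuousAt (gradLp hac hw hu) t := by
  refine tendsto_of_tendsto_norm_of_tendsto_inner
    (S := {G | ∃ (g : ℝ → ℝ) (hg2 : MemLp g 2), Continuous g ∧ HasCompactSupport g ∧
      G = hg2.toLp g}) ?_ ?_ ?_
  · intro ε hε
    obtain ⟨g, hgc, hge, hg, hg2⟩ := (memLp_deriv_profile hac hw (le_max_right t 0)
      (hu _ (le_max_right t 0))).exists_hasCompactSupport_eLpNorm_sub_le (by norm_num)
      (ε := ENNReal.ofReal (ε / 2)) (by simpa using hε)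
    refine ⟨hg2.toLp g, ⟨g, hg2, hg, hgc, rfl⟩, ?_⟩
    rw [gradLp, ← MemLp.toLp_sub, Lp.norm_toLp]
    exact (ENNReal.toReal_le_of_le_ofReal (by linarith) hge).trans_lt (by linarith)
  · have h : ∀ s, ‖gradLp hac hw hu s‖ = Real.sqrt (energy ubar (max s 0)) := fun s => by
      rw [← norm_gradLp_sq hac hw hu, Real.sqrt_sq (norm_nonneg _)]
    simp_rw [h]
    exact hc.sqrt
  · rintro _ ⟨g, hg2, hg, hgc, rfl⟩
    simp_rw [inner_gradLp hac hw hu hg hg2]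
    exact (continuous_integral_particles hac hw hg hgc).continuousAt

lemma memLp_gradLp (hac : IsAbsCont ubar)
    (hw : Integrable fun x => deriv ubar x ^ 2) (hu : IsGivenByCharacteristics ubar u)
    (T : ℝ) : MemLp (gradLp hac hw hu) ⊤ (volume.restrict (Icc (0 : ℝ) T)) := by
  refine memLp_top_of_bound (C := Real.sqrt (energy ubar 0)) ?_ (ae_of_all _ fun t => ?_)
  · refine (StronglyMeasurable.of_countable_not_continuousAt ?_).aestronglyMeasurable
    exact (antitone_energy_max hw).countable_not_continuousAt.mono fun _ ht ht' =>
      ht (continuousAt_gradLp hac hw hu ht')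
  · refine Real.le_sqrt_of_sq_le ?_
    rw [norm_gradLp_sq]
    exact energy_le hw _

/-! ### The solution as a curve in `L²([a,b])` -/

lemma memLp_restrict_of_continuous {f : ℝ → ℝ} (hf : Continuous f) (a b : ℝ) :
    MemLp f 2 (volume.restrict (Icc a b)) := by
  obtain ⟨C, hC⟩ := isCompact_Icc.exists_bound_of_continuousOn hf.continuousOn (s := Icc a b)
  exact MemLp.of_bound hf.aestronglyMeasurable C
    ((ae_restrict_iff' measurableSet_Icc).2 (ae_of_all _ hC))

lemma measurable_source {p : ℝ → ℝ} (hq : Integrable fun x => deriv p x ^ 2) :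
    Measurable (source p) := by
  have h1 : Monotone fun x => ∫ z in Iic x, deriv p z ^ 2 := fun x y h =>
    setIntegral_mono_set hq.integrableOn (ae_of_all _ fun _ => sq_nonneg _)
      (LE.le.eventuallyLE (Iic_subset_Iic.2 h))
  have h2 : Antitone fun x => ∫ z in Ioi x, deriv p z ^ 2 := fun x y h =>
    setIntegral_mono_set hq.integrableOn (ae_of_all _ fun _ => sq_nonneg _)
      (LE.le.eventuallyLE (Ioi_subset_Ioi h))
  exact (h1.measurable.sub h2.measurable).const_mul _

/-- The time derivative prescribed by the equation, `-u u_x` plus the source. -/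
def rhs (p : ℝ → ℝ) (x : ℝ) : ℝ := source p x - p x * deriv p x

lemma memLp_rhs (hac : IsAbsCont ubar) (hw : Integrable fun x => deriv ubar x ^ 2)
    {t : ℝ} (ht : 0 ≤ t) {p : ℝ → ℝ} (hp : ∀ y, p (xi ubar t y) = charValue ubar t y) (a b : ℝ) :
    MemLp (rhs p) 2 (volume.restrict (Icc a b)) := by
  have hpc := (isAbsCont_profile hac hw ht hp).continuous
  refine MemLp.sub ?_ ?_
  · refine MemLp.of_bound (measurable_source (integrable_deriv_profile_sq hac hw ht
      hp)).aestronglyMeasurable (energy ubar 0 / 4) (ae_of_all _ fun x => ?_)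
    obtain ⟨y, rfl⟩ := surjective_xi hac hw ht x
    rw [source_profile hac hw ht hp]
    exact abs_phi_le hw t y
  · obtain ⟨C, hC⟩ := isCompact_Icc.exists_bound_of_continuousOn hpc.continuousOn (s := Icc a b)
    refine MemLp.of_le_mul (c := C) ((memLp_deriv_profile hac hw ht hp).restrict _)
      (hpc.measurable.mul (measurable_deriv p)).aestronglyMeasurable
      ((ae_restrict_iff' measurableSet_Icc).2 (ae_of_all _ fun x hx => ?_))
    rw [norm_mul]
    exact mul_le_mul_of_nonneg_right (hC x hx) (norm_nonneg _)

lemma abs_xi_sub_le (hw : Integrable fun x => deriv ubar x ^ 2) {s t y M : ℝ}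
    (hv : |charValue ubar t y| ≤ M) :
    |xi ubar s y - xi ubar t y| ≤ (M + energy ubar 0 / 4 * |s - t|) * |s - t| := by
  have h1 := abs_xi_sub_sub_le hw s t y
  have h2 := abs_add_le (xi ubar s y - xi ubar t y - (s - t) * charValue ubar t y)
    ((s - t) * charValue ubar t y)
  rw [sub_add_cancel, abs_mul] at h2
  rw [← sq_abs] at h1
  have h3 := mul_le_mul_of_nonneg_left hv (abs_nonneg (s - t))
  nlinarith

lemma profile_sub_eq_integral {p : ℝ → ℝ} (h : IsAbsCont p) (a b : ℝ) :
    p b - p a = ∫ x in a..b, deriv p x :=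
  (h a b).integral_deriv_eq_sub.symm

/-- The increment of the solution in time, compared at a fixed position: follow the particle, and
return to the position along the later profile. -/
lemma abs_solution_sub_le (hac : IsAbsCont ubar) (hw : Integrable fun x => deriv ubar x ^ 2)
    (hu : IsGivenByCharacteristics ubar u) {s t x M r : ℝ} (hs : 0 ≤ s) (ht : 0 ≤ t)
    (hM : |u t x| ≤ M) (hr : (M + energy ubar 0 / 4 * |s - t|) * |s - t| ≤ r) :
    |u s x - u t x| ≤ energy ubar 0 / 4 * |s - t| + localMass (deriv (u s)) r x := by
  obtain ⟨y, rfl⟩ := surjective_xi hac hw ht x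
  rw [hu t ht] at hM ⊢
  have h1 := abs_integral_le_localMass (memLp_deriv_profile hac hw hs (hu s hs))
    ((abs_xi_sub_le hw hM).trans hr)
  rw [← profile_sub_eq_integral (isAbsCont_profile hac hw hs (hu s hs)), hu s hs] at h1
  have h2 := abs_charValue_sub_time_le hw s t y
  have h3 := abs_sub (charValue ubar s y - charValue ubar t y)
    (charValue ubar s y - u s (xi ubar t y))
  rw [sub_sub_sub_cancel_left] at h3
  linarith

lemma eLpNorm_const_restrict_le {a b c : ℝ} (hc : 0 ≤ c) :
    eLpNorm (fun _ : ℝ => c) 2 (volume.restrict (Icc a b)) ≤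
      ENNReal.ofReal (c * Real.sqrt (b - a)) := by
  have h := eLpNorm_le_of_ae_bound (p := 2) (μ := volume.restrict (Icc a b))
    (f := fun _ : ℝ => c) (C := c) (ae_of_all _ fun _ => (Real.norm_of_nonneg hc).le)
  refine h.trans (le_of_eq ?_)
  rw [Measure.restrict_apply_univ, Real.volume_Icc, mul_comm, ENNReal.ofReal_mul hc,
    Real.sqrt_eq_rpow]
  congr 1
  rcases le_or_gt 0 (b - a) with hab | hab
  · rw [ENNReal.ofReal_rpow_of_nonneg hab (by norm_num)]
    norm_num
  · rw [ENNReal.ofReal_of_nonpos hab.le, ENNReal.zero_rpow_of_pos (by norm_num), eq_comm,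
      ENNReal.ofReal_eq_zero, ← Real.sqrt_eq_rpow, Real.sqrt_eq_zero_of_nonpos hab.le]

lemma eLpNorm_localMass_restrict_le {q : ℝ → ℝ} (hqm : Measurable q) {r e : ℝ} (hr : 0 ≤ r)
    (hq : eLpNorm q 2 volume ≤ ENNReal.ofReal e) (a b : ℝ) :
    eLpNorm (localMass q r) 2 (volume.restrict (Icc a b)) ≤ ENNReal.ofReal (2 * r * e) := by
  rw [ENNReal.ofReal_mul (by positivity)]
  exact (eLpNorm_mono_measure _ Measure.restrict_le_self).trans
    ((eLpNorm_localMass_le hqm hr).trans (by gcongr))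

/-- `u(t,·)` as an element of `L²([a,b])`, extended to negative times by the initial datum. -/
def valueLp (hac : IsAbsCont ubar) (hw : Integrable fun x => deriv ubar x ^ 2)
    (hu : IsGivenByCharacteristics ubar u) (a b t : ℝ) :
    Lp ℝ 2 (volume.restrict (Icc a b)) :=
  (memLp_restrict_of_continuous (isAbsCont_profile hac hw (le_max_right t 0)
    (hu _ (le_max_right t 0))).continuous a b).toLp

lemma eLpNorm_deriv_profile (hac : IsAbsCont ubar) (hw : Integrable fun x => deriv ubar x ^ 2)
    (hu : IsGivenByCharacteristics ubar u) {t : ℝ} (ht : 0 ≤ t) :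
    eLpNorm (deriv (u t)) 2 volume ≤ ENNReal.ofReal (Real.sqrt (energy ubar 0)) := by
  have h1 := norm_gradLp_sq hac hw hu t
  have h2 : ‖gradLp hac hw hu t‖ ≤ Real.sqrt (energy ubar 0) :=
    Real.le_sqrt_of_sq_le (by rw [h1]; exact energy_le hw _)
  rw [gradLp, Lp.norm_toLp, max_eq_left ht] at h2
  exact (ENNReal.le_ofReal_iff_toReal_le (memLp_deriv_profile hac hw ht (hu t ht)).2.ne
    (Real.sqrt_nonneg _)).2 h2

lemma lipschitzOnWith_valueLp (hac : IsAbsCont ubar)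
    (hw : Integrable fun x => deriv ubar x ^ 2) (hu : IsGivenByCharacteristics ubar u)
    (a b T : ℝ) : ∃ K, LipschitzOnWith K (valueLp hac hw hu a b) (Icc 0 T) := by
  obtain ⟨M, hM0, hM⟩ := exists_abs_solution_le hac hw hu T a b
  have hE := energy_nonneg (ubar := ubar) 0
  set M' := M + energy ubar 0 / 4 * |T| with hM'def
  have hM' : 0 ≤ M' := by positivity
  set K := energy ubar 0 / 4 * Real.sqrt (b - a) + 2 * M' * Real.sqrt (energy ubar 0) with hK'
  have hK : 0 ≤ K := by positivity
  refine ⟨K.toNNReal, LipschitzOnWith.of_dist_le_mul fun s hs t ht => ?_⟩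
  rw [Real.coe_toNNReal _ hK, dist_eq_norm, Real.dist_eq, valueLp, valueLp, ← MemLp.toLp_sub,
    Lp.norm_toLp]
  refine ENNReal.toReal_le_of_le_ofReal (by positivity) ?_
  simp only [max_eq_left hs.1, max_eq_left ht.1]
  have hst : |s - t| ≤ |T| := by
    rw [abs_of_nonneg (hs.1.trans hs.2)]
    exact abs_le.2 ⟨by linarith [hs.1, ht.2], by linarith [hs.2, ht.1]⟩
  have hr : (M + energy ubar 0 / 4 * |s - t|) * |s - t| ≤ M' * |s - t| := by
    rw [hM'def]; gcongr
  have hr0 : 0 ≤ M' * |s - t| := by positivity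
  have hq2 := memLp_deriv_profile hac hw hs.1 (hu s hs.1)
  calc eLpNorm (u s - u t) 2 (volume.restrict (Icc a b))
      ≤ eLpNorm ((fun _ => energy ubar 0 / 4 * |s - t|) +
          localMass (deriv (u s)) (M' * |s - t|)) 2 (volume.restrict (Icc a b)) := by
        refine eLpNorm_mono_ae ((ae_restrict_iff' measurableSet_Icc).2 (ae_of_all _ fun x hx => ?_))
        exact (abs_solution_sub_le hac hw hu hs.1 ht.1 (hM t ht x hx) hr).trans (le_abs_self _)
    _ ≤ eLpNorm (fun _ => energy ubar 0 / 4 * |s - t|) 2 (volume.restrict (Icc a b)) +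
          eLpNorm (localMass (deriv (u s)) (M' * |s - t|)) 2 (volume.restrict (Icc a b)) :=
        eLpNorm_add_le aestronglyMeasurable_const
          (continuous_localMass hq2 _).aestronglyMeasurable (by norm_num)
    _ ≤ ENNReal.ofReal (energy ubar 0 / 4 * |s - t| * Real.sqrt (b - a)) +
          ENNReal.ofReal (2 * (M' * |s - t|) * Real.sqrt (energy ubar 0)) :=
        add_le_add (eLpNorm_const_restrict_le (by positivity))
          (eLpNorm_localMass_restrict_le (measurable_deriv _) hr0
            (eLpNorm_deriv_profile hac hw hu hs.1) a b)
    _ = ENNReal.ofReal (K * |s - t|) := by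
        rw [← ENNReal.ofReal_add (by positivity) (by positivity), hK']
        ring_nf

/-- The pointwise expansion of the solution in time. Following the particle `y` from `x = ξ(t,y)`
to `x' = ξ(s,y)` produces the source; returning from `x'` to `x` produces the transport term, after
replacing the gradient `u_x(s,·)` by `u_x(t,·)` and this by a continuous function `g`. -/
lemma abs_solution_sub_sub_le (hac : IsAbsCont ubar)
    (hw : Integrable fun x => deriv ubar x ^ 2) (hu : IsGivenByCharacteristics ubar u)
    {s t x M r δ ω G : ℝ} (hs : 0 ≤ s) (ht : 0 ≤ t) {g : ℝ → ℝ} (hg2 : MemLp g 2)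
    (hM : |u t x| ≤ M)
    (hr : (M + energy ubar 0 / 4 * |s - t|) * |s - t| ≤ r)
    (hphi : ∀ y, |charValue ubar s y - charValue ubar t y - (s - t) * phi ubar t y| ≤ δ)
    (hω : ∀ z z', |z - z'| ≤ r → |g z - g z'| ≤ ω) (hG : ∀ z, |g z| ≤ G) :
    |u s x - u t x - (s - t) * rhs (u t) x| ≤
      δ + localMass (deriv (u s) - deriv (u t)) r x + localMass (deriv (u t) - g) r x +
        (ω * r + G * (energy ubar 0 / 4 * (s - t) ^ 2)) + |s - t| * M * |deriv (u t) x - g x| := by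
  obtain ⟨y, rfl⟩ := surjective_xi hac hw ht x
  have hsL := memLp_deriv_profile hac hw hs (hu s hs)
  have htL := memLp_deriv_profile hac hw ht (hu t ht)
  set x := xi ubar t y with hx
  set x' := xi ubar s y with hx'
  have hux : u t x = charValue ubar t y := hu t ht y
  have hX : |x' - x| ≤ r := (abs_xi_sub_le hw (hux ▸ hM)).trans hr
  have h1 := abs_integral_le_localMass (hsL.sub htL) hX
  have h2 := abs_integral_le_localMass (htL.sub hg2) hX
  have hi1 := intervalIntegrable_of_memLp_two hsL x x'
  have hi2 := intervalIntegrable_of_memLp_two htL x x'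
  have hi3 := intervalIntegrable_of_memLp_two hg2 x x'
  have e1 : ∫ z in x..x', (deriv (u s) - deriv (u t)) z =
      (∫ z in x..x', deriv (u s) z) - ∫ z in x..x', deriv (u t) z :=
    intervalIntegral.integral_sub hi1 hi2
  have e2 : ∫ z in x..x', (deriv (u t) - g) z =
      (∫ z in x..x', deriv (u t) z) - ∫ z in x..x', g z :=
    intervalIntegral.integral_sub hi2 hi3
  have e3 : u s x' - u s x = ∫ z in x..x', deriv (u s) z :=
    profile_sub_eq_integral (isAbsCont_profile hac hw hs (hu s hs)) x x'
  have e4 : u s x' = charValue ubar s y := hu s hs y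
  have e5 : source (u t) x = phi ubar t y := source_profile hac hw ht (hu t ht) y
  have h3 : |(∫ z in x..x', g z) - (s - t) * u t x * g x| ≤
      ω * r + G * (energy ubar 0 / 4 * (s - t) ^ 2) := by
    have e6 : (∫ z in x..x', g z) - (s - t) * u t x * g x =
        (∫ z in x..x', (g z - g x)) + g x * (x' - x - (s - t) * charValue ubar t y) := by
      rw [intervalIntegral.integral_sub hi3 intervalIntegrable_const,
        intervalIntegral.integral_const, hux, smul_eq_mul]
      ring
    rw [e6]
    have hr0 : 0 ≤ r := (abs_nonneg _).trans hX
    have hω0 : 0 ≤ ω := (abs_nonneg _).trans (hω 0 0 (by simpa using hr0))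
    refine (abs_add_le _ _).trans (add_le_add ?_ ?_)
    · refine le_trans ?_ (mul_le_mul_of_nonneg_left hX hω0)
      rw [← Real.norm_eq_abs]
      refine intervalIntegral.norm_integral_le_of_norm_le_const fun z hz => hω z x ?_
      exact (abs_sub_left_of_mem_uIcc (uIoc_subset_uIcc hz)).trans hX
    · rw [abs_mul]
      exact mul_le_mul (hG x) (abs_xi_sub_sub_le hw s t y) (abs_nonneg _)
        ((abs_nonneg _).trans (hG x))
  have h4 : |(s - t) * u t x * (deriv (u t) x - g x)| ≤
      |s - t| * M * |deriv (u t) x - g x| := by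
    rw [abs_mul, abs_mul]
    gcongr
  have h5 := hphi y
  have key : u s x - u t x - (s - t) * rhs (u t) x =
      (charValue ubar s y - charValue ubar t y - (s - t) * phi ubar t y) -
      (∫ z in x..x', (deriv (u s) - deriv (u t)) z) - (∫ z in x..x', (deriv (u t) - g) z) -
      ((∫ z in x..x', g z) - (s - t) * u t x * g x) +
      (s - t) * u t x * (deriv (u t) x - g x) := by
    rw [e1, e2, ← e3, rhs, e4, e5, hux]
    ring
  rw [key, abs_le]
  have b1 := abs_le.1 h1
  have b2 := abs_le.1 h2
  have b3 := abs_le.1 h3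
  have b4 := abs_le.1 h4
  have b5 := abs_le.1 h5
  constructor <;> linarith [b1.1, b1.2, b2.1, b2.2, b3.1, b3.2, b4.1, b4.2, b5.1, b5.2]

lemma eLpNorm_sub_eq_norm_gradLp (hac : IsAbsCont ubar)
    (hw : Integrable fun x => deriv ubar x ^ 2) (hu : IsGivenByCharacteristics ubar u) {s t : ℝ}
    (hs : 0 ≤ s) (ht : 0 ≤ t) :
    (eLpNorm (deriv (u s) - deriv (u t)) 2 volume).toReal =
      ‖gradLp hac hw hu s - gradLp hac hw hu t‖ := by
  rw [gradLp, gradLp, ← MemLp.toLp_sub, Lp.norm_toLp]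
  simp only [max_eq_left hs, max_eq_left ht]

/-- At the times of continuity of the energy, the solution is differentiable in `L²([a,b])`, and
its derivative is given by the equation. -/
lemma hasDerivAt_valueLp (hac : IsAbsCont ubar)
    (hw : Integrable fun x => deriv ubar x ^ 2) (hu : IsGivenByCharacteristics ubar u)
    {t : ℝ} (ht : 0 < t) (hc : ContinuousAt (fun s => energy ubar (max s 0)) t) (a b : ℝ) :
    HasDerivAt (valueLp hac hw hu a b) (memLp_rhs hac hw ht.le (hu t ht.le) a b).toLp t := by
  obtain ⟨M, hM0, hM⟩ := exists_abs_solution_le hac hw hu t a b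
  have hM := hM t ⟨ht.le, le_rfl⟩
  have hE := energy_nonneg (ubar := ubar) 0
  have hce : ContinuousAt (energy ubar) t := by
    refine hc.congr ?_
    filter_upwards [eventually_gt_nhds ht] with s hs
    rw [max_eq_left hs.le]
  -- a bound for the speed of the particles in `[a,b]` when `|s - t| ≤ 1`
  set M' := M + energy ubar 0 / 4 with hM'def
  have hM' : 0 ≤ M' := by positivity
  have htL := memLp_deriv_profile hac hw ht.le (hu t ht.le)
  rw [hasDerivAt_iff_isLittleO, Asymptotics.isLittleO_iff]
  intro c hc0
  -- the four error terms below add up to `(2 √(b - a) + 4 M' + M) e |s - t|`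
  set e := c / (2 * Real.sqrt (b - a) + 4 * M' + M + 1) with hedef
  have he : 0 < e := by positivity
  obtain ⟨g, hgc, hge, hg, hg2⟩ := htL.exists_hasCompactSupport_eLpNorm_sub_le (by norm_num)
      (ε := ENNReal.ofReal e) (by simpa using he)
  obtain ⟨G, hG⟩ := hgc.exists_bound_of_continuous hg
  have hG0 : 0 ≤ G := (norm_nonneg _).trans (hG 0)
  set ω := e / (2 * (M' + 1)) with hωdef
  have hω0 : 0 < ω := by positivity
  obtain ⟨δ, hδ, hδ'⟩ := Metric.uniformContinuous_iff.1
    (hgc.uniformContinuous_of_continuous hg) ω hω0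
  have hlim : Tendsto (fun s => |s - t|) (𝓝 t) (𝓝 0) := by
    have h : Continuous fun s : ℝ => |s - t| := by fun_prop
    simpa using h.tendsto t
  have hlim1 : ∀ᶠ s in 𝓝 t, M' * |s - t| < δ :=
    (by simpa using hlim.const_mul M' : Tendsto _ _ (𝓝 (0 : ℝ))).eventually_lt_const hδ
  have hlim2 : ∀ᶠ s in 𝓝 t, G * (energy ubar 0 / 4) * |s - t| < e / 2 :=
    (by simpa using hlim.const_mul (G * (energy ubar 0 / 4)) :
      Tendsto _ _ (𝓝 (0 : ℝ))).eventually_lt_const (by positivity)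
  have hlim3 : ∀ᶠ s in 𝓝 t, ‖gradLp hac hw hu s - gradLp hac hw hu t‖ < e := by
    have h := (continuousAt_gradLp hac hw hu hc).sub (continuousAt_const (y := gradLp hac hw hu t))
    have h' := h.norm
    simp only [ContinuousAt, Pi.sub_apply, sub_self, norm_zero] at h'
    exact h'.eventually_lt_const he
  filter_upwards [hlim.eventually_le_const zero_lt_one, hlim1, hlim2, hlim3,
    eventually_gt_nhds ht, eventually_abs_charValue_sub_sub_le hw ht hce he]
    with s hs1 hsδ hsG hsQ hs0 hsv
  have hsL := memLp_deriv_profile hac hw hs0.le (hu s hs0.le)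
  set r := M' * |s - t| with hrdef
  have hr0 : 0 ≤ r := by positivity
  have hr : (M + energy ubar 0 / 4 * |s - t|) * |s - t| ≤ r := by
    rw [hrdef, hM'def]
    gcongr
    exact mul_le_of_le_one_right (by positivity) hs1
  have hsmall : ω * r + G * (energy ubar 0 / 4 * (s - t) ^ 2) ≤ e * |s - t| := by
    have h1 : ω * r ≤ e / 2 * |s - t| := by
      rw [hrdef, ← mul_assoc]
      refine mul_le_mul_of_nonneg_right ?_ (abs_nonneg _)
      rw [hωdef, div_mul_eq_mul_div, div_le_div_iff₀ (by positivity) (by norm_num)]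
      nlinarith
    have h2 : G * (energy ubar 0 / 4 * (s - t) ^ 2) ≤ e / 2 * |s - t| := by
      rw [← sq_abs, sq]
      calc _ = (G * (energy ubar 0 / 4) * |s - t|) * |s - t| := by ring
        _ ≤ _ := mul_le_mul_of_nonneg_right hsG.le (abs_nonneg _)
    linarith
  have hq : eLpNorm (deriv (u s) - deriv (u t)) 2 volume ≤ ENNReal.ofReal e := by
    refine (ENNReal.le_ofReal_iff_toReal_le (hsL.sub htL).2.ne he.le).2 ?_
    rw [eLpNorm_sub_eq_norm_gradLp hac hw hu hs0.le ht.le]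
    exact hsQ.le
  have hpt : ∀ x ∈ Icc a b, |u s x - u t x - (s - t) * rhs (u t) x| ≤
      2 * e * |s - t| + localMass (deriv (u s) - deriv (u t)) r x +
        localMass (deriv (u t) - g) r x + |s - t| * M * |deriv (u t) x - g x| := by
    intro x hx
    have h1 := abs_solution_sub_sub_le hac hw hu hs0.le ht.le hg2 (hM x hx) hr hsv
      (fun z z' hz => (hδ' (by rw [Real.dist_eq]; exact hz.trans_lt hsδ)).le) hG
    linarith
  have hm1 : AEStronglyMeasurable (localMass (deriv (u s) - deriv (u t)) r)
      (volume.restrict (Icc a b)) := (continuous_localMass (hsL.sub htL) r).aestronglyMeasurable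
  have hm2 : AEStronglyMeasurable (localMass (deriv (u t) - g) r)
      (volume.restrict (Icc a b)) := (continuous_localMass (htL.sub hg2) r).aestronglyMeasurable
  have hm3 : Measurable fun x => |s - t| * M * |deriv (u t) x - g x| := by
    have := measurable_deriv (u t)
    have := hg.measurable
    fun_prop
  have hnorm : ‖valueLp hac hw hu a b s - valueLp hac hw hu a b t - (s - t) •
      (memLp_rhs hac hw ht.le (hu t ht.le) a b).toLp‖ =
      (eLpNorm (u s - u t - (s - t) • rhs (u t)) 2 (volume.restrict (Icc a b))).toReal := by
    rw [valueLp, valueLp, ← MemLp.toLp_sub, ← MemLp.toLp_const_smul, ← MemLp.toLp_sub,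
      Lp.norm_toLp]
    simp only [max_eq_left hs0.le, max_eq_left ht.le]
  rw [hnorm, Real.norm_eq_abs]
  refine ENNReal.toReal_le_of_le_ofReal (by positivity) ?_
  calc eLpNorm (u s - u t - (s - t) • rhs (u t)) 2 (volume.restrict (Icc a b))
      ≤ eLpNorm ((fun _ => 2 * e * |s - t|) + localMass (deriv (u s) - deriv (u t)) r +
          localMass (deriv (u t) - g) r + fun x => |s - t| * M * |deriv (u t) x - g x|) 2
          (volume.restrict (Icc a b)) := by
        refine eLpNorm_mono_ae ((ae_restrict_iff' measurableSet_Icc).2 (ae_of_all _ fun x hx => ?_))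
        exact (hpt x hx).trans (le_abs_self _)
    _ ≤ ENNReal.ofReal (2 * e * |s - t| * Real.sqrt (b - a)) + ENNReal.ofReal (2 * r * e) +
          ENNReal.ofReal (2 * r * e) + ENNReal.ofReal (|s - t| * M * e) := by
        refine (eLpNorm_add_le ((aestronglyMeasurable_const.add hm1).add hm2)
          hm3.aestronglyMeasurable (by norm_num)).trans (add_le_add ?_ ?_)
        · refine (eLpNorm_add_le (aestronglyMeasurable_const.add hm1) hm2 (by norm_num)).trans
            (add_le_add ?_ ?_)
          · refine (eLpNorm_add_le aestronglyMeasurable_const hm1 (by norm_num)).trans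
              (add_le_add (eLpNorm_const_restrict_le (by positivity)) ?_)
            exact eLpNorm_localMass_restrict_le
              ((measurable_deriv _).sub (measurable_deriv _)) hr0 hq a b
          · exact eLpNorm_localMass_restrict_le
              ((measurable_deriv _).sub hg.measurable) hr0 hge a b
        · rw [ENNReal.ofReal_mul (by positivity)]
          refine (eLpNorm_le_mul_eLpNorm_of_ae_le_mul (g := deriv (u t) - g)
            (c := |s - t| * M) (ae_of_all _ fun x => ?_) 2).trans ?_
          · rw [norm_mul, Real.norm_of_nonneg (by positivity : 0 ≤ |s - t| * M), norm_abs_eq_norm]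
            rfl
          · gcongr
            exact (eLpNorm_mono_measure _ Measure.restrict_le_self).trans hge
    _ = ENNReal.ofReal ((2 * Real.sqrt (b - a) + 4 * M' + M) * e * |s - t|) := by
        rw [← ENNReal.ofReal_add (by positivity) (by positivity),
          ← ENNReal.ofReal_add (by positivity) (by positivity),
          ← ENNReal.ofReal_add (by positivity) (by positivity), hrdef]
        ring_nf
    _ ≤ ENNReal.ofReal (c * |s - t|) := by
        refine ENNReal.ofReal_le_ofReal (mul_le_mul_of_nonneg_right ?_ (abs_nonneg _))
        rw [hedef, mul_div_assoc', div_le_iff₀ (by positivity)]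
        nlinarith

lemma isWeakSolutionOn_of_isGivenByCharacteristics (hac : IsAbsCont ubar)
    (hw : Integrable fun x => deriv ubar x ^ 2) (hu : IsGivenByCharacteristics ubar u)
    {T : ℝ} (hT : 0 < T) : IsWeakSolutionOn ubar T u where
  continuousOn := (continuousOn_solution hac hw hu).mono
    (prod_mono Icc_subset_Ici_self le_rfl)
  initial x := by
    have h := hu 0 le_rfl x
    rwa [xi_zero, charValue_zero] at h
  absCont t ht := isAbsCont_profile hac hw ht.1 (hu t ht.1)
  deriv_memLp t ht := memLp_deriv_profile hac hw ht.1 (hu t ht.1)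
  deriv_bounded := by
    refine ⟨gradLp hac hw hu, fun t ht => ?_, memLp_gradLp hac hw hu T⟩
    have h := MemLp.coeFn_toLp (memLp_deriv_profile hac hw (le_max_right t 0)
      (hu _ (le_max_right t 0)))
    exact h.trans (by rw [max_eq_left ht.1])
  equation a b _ := by
    refine ⟨valueLp hac hw hu a b, fun t ht => ?_, ?_, ?_⟩
    · have h := MemLp.coeFn_toLp (memLp_restrict_of_continuous (isAbsCont_profile hac hw
        (le_max_right t 0) (hu _ (le_max_right t 0))).continuous a b)
      exact h.trans (by rw [max_eq_left ht.1])
    · obtain ⟨K, hK⟩ := lipschitzOnWith_valueLp hac hw hu a b T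
      rw [← uIcc_of_le hT.le] at hK
      exact hK.absolutelyContinuousOnInterval
    · rw [ae_restrict_iff' measurableSet_Icc]
      filter_upwards [(antitone_energy_max hw).countable_not_continuousAt.ae_notMem volume,
        (countable_singleton (0 : ℝ)).ae_notMem volume] with t hc ht0 ht
      have ht' : 0 < t := lt_of_le_of_ne ht.1 (Ne.symm ht0)
      refine ⟨_, hasDerivAt_valueLp hac hw hu ht' (not_not.1 hc) a b, ?_⟩
      filter_upwards [MemLp.coeFn_toLp (memLp_rhs hac hw ht'.le (hu t ht'.le) a b),
        ae_restrict_of_ae (isAbsCont_profile hac hw ht.1 (hu t ht.1)).ae_differentiableAt]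
        with x hx hd
      have h : HasDerivAt (fun z => u t z ^ 2 / 2) (u t x * deriv (u t) x) x := by
        convert! (hd.hasDerivAt.pow 2).div_const 2 using 1
        norm_num
        ring
      rw [hx, h.deriv, rhs]
      ring

/-! ### Dissipation of the energy -/

/-- The derivative `ψ_t + u ψ_x` of a test function `ψ` along the characteristic issued from `y`. -/
def materialDeriv (ubar : ℝ → ℝ) (ψ : ℝ × ℝ → ℝ) (t y : ℝ) : ℝ :=
  fderiv ℝ ψ (t, xi ubar t y) (1, charValue ubar t y)

lemma hasDerivAt_comp_xi (hw : Integrable fun x => deriv ubar x ^ 2) {ψ : ℝ × ℝ → ℝ}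
    (hψ : ContDiff ℝ 1 ψ) (t y : ℝ) :
    HasDerivAt (fun s => ψ (s, xi ubar s y)) (materialDeriv ubar ψ t y) t :=
  ((hψ.differentiable one_ne_zero _).hasFDerivAt).comp_hasDerivAt t
    ((hasDerivAt_id t).prodMk (hasDerivAt_xi hw t y))

lemma continuous_materialDeriv_time (hw : Integrable fun x => deriv ubar x ^ 2) {ψ : ℝ × ℝ → ℝ}
    (hψ : ContDiff ℝ 1 ψ) (y : ℝ) : Continuous fun t => materialDeriv ubar ψ t y := by
  have h1 := hψ.continuous_fderiv one_ne_zero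
  have h2 := continuous_xi_time hw y
  have h3 := continuous_charValue_time hw y
  exact (h1.comp (continuous_id.prodMk h2)).clm_apply (continuous_const.prodMk h3)

lemma continuousOn_materialDeriv (hac : IsAbsCont ubar)
    (hw : Integrable fun x => deriv ubar x ^ 2) {ψ : ℝ × ℝ → ℝ} (hψ : ContDiff ℝ 1 ψ) :
    ContinuousOn (fun p : ℝ × ℝ => materialDeriv ubar ψ p.1 p.2) (Ici 0 ×ˢ univ) := by
  rintro ⟨t, y⟩ ⟨ht, -⟩
  refine ContinuousAt.continuousWithinAt ?_
  have h2 := continuousAt_xi_prod hac hw ht y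
  have h3 := continuousAt_charValue_prod hac hw ht y
  refine ContinuousAt.clm_apply ?_ (continuousAt_const.prodMk h3)
  exact ContinuousAt.comp (f := fun p : ℝ × ℝ => (p.1, xi ubar p.1 p.2)) (g := fderiv ℝ ψ)
    (hψ.continuous_fderiv one_ne_zero).continuousAt (continuousAt_fst.prodMk h2)

lemma exists_abs_materialDeriv_le (hac : IsAbsCont ubar)
    (hw : Integrable fun x => deriv ubar x ^ 2) {ψ : ℝ × ℝ → ℝ} (hψ : ContDiff ℝ 1 ψ)
    (hc : HasCompactSupport ψ) {T : ℝ} (hT : 0 ≤ T) :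
    ∃ H, ∀ t ∈ Icc 0 T, ∀ y, |materialDeriv ubar ψ t y| ≤ H := by
  obtain ⟨R, hR⟩ := (hc.fderiv ℝ).isCompact.isBounded.exists_norm_le
  obtain ⟨B, hB⟩ := exists_abs_le_of_abs_xi_le hac hw hT R
  obtain ⟨H, hH⟩ := (isCompact_Icc.prod isCompact_Icc).exists_bound_of_continuousOn
    ((continuousOn_materialDeriv hac hw hψ).mono
      (prod_mono Icc_subset_Ici_self (subset_univ _) : Icc 0 T ×ˢ Icc (-B) B ⊆ _))
  refine ⟨|H|, fun t ht y => ?_⟩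
  by_cases h : fderiv ℝ ψ (t, xi ubar t y) = 0
  · simp [materialDeriv, h]
  · have h1 := hR _ (subset_tsupport (fderiv ℝ ψ) h)
    have h2 : |xi ubar t y| ≤ R := (norm_snd_le _).trans h1
    exact (hH (t, y) ⟨ht, abs_le.1 (hB t ht y h2)⟩).trans (le_abs_self H)

/-- The energy balance of a single particle: its weight `ψ` is transported while it is alive, and
the nonnegative weight it has at the blow-up time is lost. -/
lemma indicator_sub_le_integral_materialDeriv (hw : Integrable fun x => deriv ubar x ^ 2)
    {ψ : ℝ × ℝ → ℝ} (hψ : ContDiff ℝ 1 ψ) (h0 : ∀ t, 0 ≤ t → ∀ x, 0 ≤ ψ (t, x)) {t₁ t₂ : ℝ}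
    (ht₁ : 0 ≤ t₁) (h12 : t₁ ≤ t₂) (y : ℝ) :
    (aliveSet ubar t₂).indicator (fun _ => ψ (t₂, xi ubar t₂ y)) y -
      (aliveSet ubar t₁).indicator (fun _ => ψ (t₁, xi ubar t₁ y)) y ≤
      ∫ t in t₁..t₂, (aliveSet ubar t).indicator (fun _ => materialDeriv ubar ψ t y) y := by
  have hcont := continuous_materialDeriv_time hw hψ y
  have hftc : ∀ a b : ℝ, ∫ t in a..b, materialDeriv ubar ψ t y =
      ψ (b, xi ubar b y) - ψ (a, xi ubar a y) := fun a b =>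
    intervalIntegral.integral_eq_sub_of_hasDerivAt (fun t _ => hasDerivAt_comp_xi hw hψ t y)
      (hcont.intervalIntegrable a b)
  by_cases hy2 : y ∈ aliveSet ubar t₂
  · have h : ∫ t in t₁..t₂, (aliveSet ubar t).indicator (fun _ => materialDeriv ubar ψ t y) y =
        ∫ t in t₁..t₂, materialDeriv ubar ψ t y := by
      refine intervalIntegral.integral_congr fun t ht => ?_
      rw [uIcc_of_le h12] at ht
      exact indicator_of_mem (aliveSet_antitone (ht₁.trans ht.1) ht.2 hy2) _
    rw [h, hftc, indicator_of_mem hy2, indicator_of_mem (aliveSet_antitone ht₁ h12 hy2)]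
  by_cases hy1 : y ∈ aliveSet ubar t₁
  · -- the particle blows up at the time `τ ∈ (t₁, t₂]`
    have h1 := (mem_aliveSet_iff ht₁ y).1 hy1
    have h2 := fun h => hy2 ((mem_aliveSet_iff (ht₁.trans h12) y).2 h)
    have hneg : deriv ubar y < 0 := by
      by_contra! h
      exact h2 (by have := mul_nonneg (ht₁.trans h12) h; linarith)
    set τ := -2 / deriv ubar y with hτ
    have hmul : τ * deriv ubar y = -2 := div_mul_cancel₀ _ hneg.ne
    have hiff : ∀ t, 0 ≤ t → (y ∈ aliveSet ubar t ↔ t < τ) := fun t ht => by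
      rw [mem_aliveSet_iff ht, ← mul_lt_mul_right_of_neg hneg (a := τ), hmul]
      constructor <;> intro h <;> linarith
    have h1τ : t₁ < τ := (hiff t₁ ht₁).1 hy1
    have h2τ : τ ≤ t₂ := not_lt.1 fun h => hy2 ((hiff t₂ (ht₁.trans h12)).2 h)
    have hA : ∀ᵐ t, t ∈ uIoc t₁ τ → (aliveSet ubar t).indicator
        (fun _ => materialDeriv ubar ψ t y) y = materialDeriv ubar ψ t y := by
      filter_upwards [(countable_singleton τ).ae_notMem volume] with t hne ht
      rw [uIoc_of_le h1τ.le] at ht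
      exact indicator_of_mem ((hiff t (ht₁.trans ht.1.le)).2 (lt_of_le_of_ne ht.2 hne)) _
    have hB : ∀ᵐ t, t ∈ uIoc τ t₂ → (aliveSet ubar t).indicator
        (fun _ => materialDeriv ubar ψ t y) y = 0 := by
      refine ae_of_all _ fun t ht => ?_
      rw [uIoc_of_le h2τ] at ht
      refine indicator_of_notMem (fun h => ?_) _
      exact ht.1.not_gt ((hiff t ((ht₁.trans h1τ.le).trans ht.1.le)).1 h)
    have hiA : IntervalIntegrable (fun t => (aliveSet ubar t).indicator
        (fun _ => materialDeriv ubar ψ t y) y) volume t₁ τ :=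
      (hcont.intervalIntegrable t₁ τ).congr_ae
        ((ae_restrict_iff' measurableSet_uIoc).2 (hA.mono fun t h ht => (h ht).symm))
    have hiB : IntervalIntegrable (fun t => (aliveSet ubar t).indicator
        (fun _ => materialDeriv ubar ψ t y) y) volume τ t₂ :=
      (intervalIntegrable_const (c := (0 : ℝ))).congr_ae
        ((ae_restrict_iff' measurableSet_uIoc).2 (hB.mono fun t h ht => (h ht).symm))
    rw [← intervalIntegral.integral_add_adjacent_intervals hiA hiB,
      intervalIntegral.integral_congr_ae hA, intervalIntegral.integral_congr_ae hB, hftc,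
      indicator_of_notMem hy2, indicator_of_mem hy1]
    have := h0 τ (ht₁.trans h1τ.le) (xi ubar τ y)
    simp only [intervalIntegral.integral_zero]
    linarith
  · have h : ∫ t in t₁..t₂, (aliveSet ubar t).indicator (fun _ => materialDeriv ubar ψ t y) y =
        ∫ t in t₁..t₂, 0 := by
      refine intervalIntegral.integral_congr fun t ht => ?_
      rw [uIcc_of_le h12] at ht
      exact indicator_of_notMem (fun h => hy1 (aliveSet_antitone ht₁ ht.1 h)) _
    rw [h, indicator_of_notMem hy2, indicator_of_notMem hy1]
    simp

/-- The flux of the weighted energy, in terms of particles. -/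
lemma integral_flux_eq (hac : IsAbsCont ubar)
    (hw : Integrable fun x => deriv ubar x ^ 2) {ψ : ℝ × ℝ → ℝ} (hψ : ContDiff ℝ 1 ψ) {t : ℝ}
    (ht : 0 ≤ t) {p : ℝ → ℝ} (hp : ∀ y, p (xi ubar t y) = charValue ubar t y) :
    ∫ x, (deriv p x ^ 2 * deriv (fun s => ψ (s, x)) t +
      p x * deriv p x ^ 2 * deriv (fun z => ψ (t, z)) x) =
    ∫ y, deriv ubar y ^ 2 *
      (aliveSet ubar t).indicator (fun _ => materialDeriv ubar ψ t y) y := by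
  have hd : ∀ x, HasFDerivAt ψ (fderiv ℝ ψ (t, x)) (t, x) := fun x =>
    (hψ.differentiable one_ne_zero _).hasFDerivAt
  have h1 : ∀ x, deriv (fun s => ψ (s, x)) t = fderiv ℝ ψ (t, x) (1, 0) := fun x =>
    ((hd x).comp_hasDerivAt t ((hasDerivAt_id t).prodMk (hasDerivAt_const t x))).deriv
  have h2 : ∀ x, deriv (fun z => ψ (t, z)) x = fderiv ℝ ψ (t, x) (0, 1) := fun x =>
    ((hd x).comp_hasDerivAt x ((hasDerivAt_const x t).prodMk (hasDerivAt_id x))).deriv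
  have h3 : ∀ x, deriv p x ^ 2 * deriv (fun s => ψ (s, x)) t +
      p x * deriv p x ^ 2 * deriv (fun z => ψ (t, z)) x =
      deriv p x ^ 2 * fderiv ℝ ψ (t, x) (1, p x) := by
    intro x
    have h4 : ((1 : ℝ), p x) = (1, 0) + p x • ((0 : ℝ), (1 : ℝ)) := by simp
    rw [h1, h2, h4, map_add, map_smul, smul_eq_mul]
    ring
  have hm : Measurable fun x => fderiv ℝ ψ (t, x) (1, p x) := by
    have h5 := hψ.continuous_fderiv one_ne_zero
    have h6 := (isAbsCont_profile hac hw ht hp).continuous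
    exact ((h5.comp (continuous_const.prodMk continuous_id)).clm_apply
      (continuous_const.prodMk h6)).measurable
  simp_rw [h3]
  rw [integral_deriv_profile_sq_mul hac hw ht hp hm,
    ← integral_indicator (measurableSet_aliveSet t)]
  refine integral_congr_ae (ae_of_all _ fun y => ?_)
  by_cases h : y ∈ aliveSet ubar t <;> simp [h, materialDeriv, hp]

lemma integrable_particle_weight (hac : IsAbsCont ubar)
    (hw : Integrable fun x => deriv ubar x ^ 2) {ψ : ℝ × ℝ → ℝ} (hψ : Continuous ψ)
    (hc : HasCompactSupport ψ) {t : ℝ} (ht : 0 ≤ t) :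
    Integrable fun y => deriv ubar y ^ 2 *
      (aliveSet ubar t).indicator (fun _ => ψ (t, xi ubar t y)) y := by
  obtain ⟨C, hC⟩ := hc.exists_bound_of_continuous hψ
  have hm : Measurable fun y => ψ (t, xi ubar t y) :=
    (hψ.comp (continuous_const.prodMk (continuous_xi hac hw ht))).measurable
  have h1 : Integrable fun y => deriv ubar y ^ 2 * ψ (t, xi ubar t y) :=
    hw.mul_bdd hm.aestronglyMeasurable (ae_of_all _ fun y => hC _)
  refine (h1.indicator (measurableSet_aliveSet (ubar := ubar) t)).congr (ae_of_all _ fun y => ?_)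
  by_cases h : y ∈ aliveSet ubar t <;> simp [h]

lemma integral_weight_eq (hac : IsAbsCont ubar)
    (hw : Integrable fun x => deriv ubar x ^ 2) {ψ : ℝ × ℝ → ℝ} (hψ : Continuous ψ) {t : ℝ}
    (ht : 0 ≤ t) {p : ℝ → ℝ} (hp : ∀ y, p (xi ubar t y) = charValue ubar t y) :
    ∫ x, deriv p x ^ 2 * ψ (t, x) = ∫ y, deriv ubar y ^ 2 *
      (aliveSet ubar t).indicator (fun _ => ψ (t, xi ubar t y)) y := by
  rw [integral_deriv_profile_sq_mul hac hw ht hp (g := fun x => ψ (t, x))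
    (hψ.comp (continuous_const.prodMk continuous_id)).measurable,
    ← integral_indicator (measurableSet_aliveSet t)]
  refine integral_congr_ae (ae_of_all _ fun y => ?_)
  by_cases h : y ∈ aliveSet ubar t <;> simp [h]

lemma isDissipative_of_isGivenByCharacteristics (hac : IsAbsCont ubar)
    (hw : Integrable fun x => deriv ubar x ^ 2) (hu : IsGivenByCharacteristics ubar u) :
    IsDissipative u := by
  intro ψ hψ hc h0 t₁ t₂ ht₁ h12
  have ht₂ := ht₁.trans h12
  obtain ⟨H, hH⟩ := exists_abs_materialDeriv_le hac hw hψ hc ht₂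
  have hI2 := integrable_particle_weight hac hw hψ.continuous hc ht₂
  have hI1 := integrable_particle_weight hac hw hψ.continuous hc ht₁
  -- the weighted energy flux is integrable in time and particles
  have hprod : Integrable (Function.uncurry fun t y => deriv ubar y ^ 2 *
      (aliveSet ubar t).indicator (fun _ => materialDeriv ubar ψ t y) y)
      ((volume.restrict (Ioc t₁ t₂)).prod volume) := by
    have hbound : Integrable (fun p : ℝ × ℝ => H * deriv ubar p.2 ^ 2)
        ((volume.restrict (Ioc t₁ t₂)).prod volume) :=
      Integrable.mul_prod (integrable_const H) hw
    have hmeas : AEStronglyMeasurable (fun p : ℝ × ℝ => materialDeriv ubar ψ p.1 p.2)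
        ((volume.restrict (Ioc t₁ t₂)).prod volume) := by
      have h := ((continuousOn_materialDeriv hac hw hψ).mono (prod_mono
        (fun t ht => ht₁.trans ht.1.le) le_rfl : Ioc t₁ t₂ ×ˢ univ ⊆ _)).aestronglyMeasurable
        (μ := volume) (measurableSet_Ioc.prod MeasurableSet.univ)
      rwa [Measure.volume_eq_prod, ← Measure.prod_restrict, Measure.restrict_univ] at h
    have hw' : AEStronglyMeasurable (fun p : ℝ × ℝ => deriv ubar p.2 ^ 2)
        ((volume.restrict (Ioc t₁ t₂)).prod volume) :=
      (((measurable_deriv ubar).comp measurable_snd).pow_const 2).aestronglyMeasurable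
    have hcongr : (Function.uncurry fun t y => deriv ubar y ^ 2 *
        (aliveSet ubar t).indicator (fun _ => materialDeriv ubar ψ t y) y) =
        {p : ℝ × ℝ | p.2 ∈ aliveSet ubar p.1}.indicator
          (fun p => deriv ubar p.2 ^ 2 * materialDeriv ubar ψ p.1 p.2) := by
      funext p
      by_cases h : p.2 ∈ aliveSet ubar p.1 <;> simp [h, Function.uncurry]
    rw [hcongr]
    refine (hbound.mono (hw'.mul hmeas) ?_).indicator measurableSet_aliveSet_prod
    have hae : ∀ᵐ p : ℝ × ℝ ∂((volume.restrict (Ioc t₁ t₂)).prod volume), p.1 ∈ Ioc t₁ t₂ :=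
      Measure.quasiMeasurePreserving_fst.ae (ae_restrict_mem measurableSet_Ioc)
    filter_upwards [hae] with p hp
    rw [Pi.mul_apply, norm_mul, norm_mul, mul_comm]
    refine mul_le_mul_of_nonneg_right ?_ (norm_nonneg _)
    exact (hH p.1 ⟨ht₁.trans hp.1.le, hp.2⟩ p.2).trans (le_abs_self H)
  have hflux : ∫ t in t₁..t₂, ∫ x, (deriv (u t) x ^ 2 * deriv (fun s => ψ (s, x)) t +
      u t x * deriv (u t) x ^ 2 * deriv (fun z => ψ (t, z)) x) =
      ∫ y, deriv ubar y ^ 2 * ∫ t in t₁..t₂,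
        (aliveSet ubar t).indicator (fun _ => materialDeriv ubar ψ t y) y := by
    rw [intervalIntegral.integral_of_le h12]
    calc _ = ∫ t in Ioc t₁ t₂, ∫ y, deriv ubar y ^ 2 *
          (aliveSet ubar t).indicator (fun _ => materialDeriv ubar ψ t y) y :=
          setIntegral_congr_fun measurableSet_Ioc fun t ht =>
            integral_flux_eq hac hw hψ (ht₁.trans ht.1.le) (hu t (ht₁.trans ht.1.le))
      _ = _ := by
          rw [integral_integral_swap hprod]
          simp_rw [intervalIntegral.integral_of_le h12, integral_const_mul]
  have hI : Integrable fun y => deriv ubar y ^ 2 * ∫ t in t₁..t₂,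
      (aliveSet ubar t).indicator (fun _ => materialDeriv ubar ψ t y) y := by
    have h := hprod.integral_prod_right
    simp only [Function.uncurry, integral_const_mul] at h
    simpa only [intervalIntegral.integral_of_le h12] using h
  rw [hflux, integral_weight_eq hac hw hψ.continuous ht₂ (hu t₂ ht₂),
    integral_weight_eq hac hw hψ.continuous ht₁ (hu t₁ ht₁), ← integral_sub hI2 hI1]
  refine integral_mono (hI2.sub hI1) hI fun y => ?_
  dsimp only
  rw [← mul_sub]
  exact mul_le_mul_of_nonneg_left
    (indicator_sub_le_integral_materialDeriv hw hψ h0 ht₁ h12 y) (sq_nonneg _)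

lemma exists_isGivenByCharacteristics (hac : IsAbsCont ubar)
    (hw : Integrable fun x => deriv ubar x ^ 2) :
    ∃ u : ℝ → ℝ → ℝ, IsGivenByCharacteristics ubar u := by
  refine ⟨fun t x => charValue ubar t (Function.invFun (xi ubar t) x), fun t ht y => ?_⟩
  exact charValue_eq_of_xi_eq hac hw ht (Function.invFun_eq ⟨y, rfl⟩)

end HunterSaxton
end

theorem theorem1 (ubar : ℝ → ℝ) (hac : HunterSaxton.IsAbsCont ubar)
    (hL2 : MemLp (deriv ubar) 2 volume) :
    -- the time integrals in the formulas converge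
    (∀ y t : ℝ, 0 ≤ t → IntervalIntegrable (fun s => HunterSaxton.phi ubar s y) volume 0 t) ∧
    -- the maps `ξ(t,·)` are nondecreasing and onto
    (∀ t : ℝ, 0 ≤ t →
      Monotone (HunterSaxton.xi ubar t) ∧ Function.Surjective (HunterSaxton.xi ubar t)) ∧
    -- the value formula is unambiguous
    (∀ t : ℝ, 0 ≤ t → ∀ y₁ y₂ : ℝ, HunterSaxton.xi ubar t y₁ = HunterSaxton.xi ubar t y₂ →
      HunterSaxton.charValue ubar t y₁ = HunterSaxton.charValue ubar t y₂) ∧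
    -- it defines a function, and this function is a dissipative solution with the stated energy
    (∃ u : ℝ → ℝ → ℝ, HunterSaxton.IsGivenByCharacteristics ubar u) ∧
    (∀ u : ℝ → ℝ → ℝ, HunterSaxton.IsGivenByCharacteristics ubar u →
      HunterSaxton.IsGlobalDissipativeSolution ubar u ∧
      ∀ t : ℝ, 0 ≤ t →
        ∫ x, (deriv (u t) x) ^ 2 =
          ∫ x in HunterSaxton.aliveSet ubar t, (deriv ubar x) ^ 2) := by
  have hw := hL2.integrable_sq
  refine ⟨fun y t _ => HunterSaxton.intervalIntegrable_phi hw y 0 t,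
    fun t ht => ⟨HunterSaxton.monotone_xi hac hw ht, HunterSaxton.surjective_xi hac hw ht⟩,
    fun t ht y₁ y₂ h => HunterSaxton.charValue_eq_of_xi_eq hac hw ht h,
    HunterSaxton.exists_isGivenByCharacteristics hac hw,
    fun u hu => ⟨⟨fun T hT =>
      HunterSaxton.isWeakSolutionOn_of_isGivenByCharacteristics hac hw hu hT,
      HunterSaxton.isDissipative_of_isGivenByCharacteristics hac hw hu⟩,
      fun t ht => HunterSaxton.integral_deriv_profile_sq hac hw ht (hu t ht)⟩⟩
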